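/- Let $H$ be a Hilbert module over a $C^*$-algebra $\mathfrak A$ (unital or not), and let $\mathcal L(H,K)$ denote the adjointable operators $H\to K$, with $\mathcal L(H)=\mathcal L(H,H)$. A projection is a self-adjoint idempotent; $\mathcal R(\cdot)$, $\mathcal N(\cdot)$ denote range and null space. Let $P\in\mathcal L(H)$ be a projection with $P\neq 0$, $P\neq I$, and let $Q\in\mathcal L(H)$ be an idempotent such that $(P,Q)$ is a harmonious quasi-projection pair, that is, $$PQ^*P=PQP,\quad PQ^*(I-P)=-PQ(I-P),\quad (I-P)Q^*(I-P)=(I-P)Q(I-P),$$ and the closed submodules $\overline{\mathcal R(PQ(I-P))}$ and $\overline{\mathcal R((I-P)QP)}$ are orthogonally complemented in $H$. Let $U_P:H\to\mathcal R(P)\oplus\mathcal N(P)$ be the unitary $U_Ph=(Ph,(I-P)h)^T$. A canonical $2\times2$ block matrix representation of $Q$ induced by $P$ consists of a self-adjoint $A\in\mathcal L(\mathcal R(P))$ with $A^2-A\ge 0$, a partial isometry $U\in\mathcal L(\mathcal R(P),\mathcal N(P))$ and a projection $Q_0\in\mathcal L(\mathcal N(P))$ such that $\mathcal R(U^*)=\overline{\mathcal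 R(A^2-A)}$, $U^*Q_0=0$ and $$U_PQU_P^*=\begin{pmatrix}A&-\ell(A)U^*\\ U\ell(A)&U(I_{\mathcal R(P)}-A)U^*+Q_0\end{pmatrix},\qquad \ell(A)=(A^2-A)^{1/2}.$$ Then such a representation exists, and the closed submodule $\mathcal N(Q)$ is orthogonally complemented in $H$; let $P_{\mathcal N(Q)}$ be the projection of $H$ onto it. Moreover, for every such representation $(A,U,Q_0)$ the operator $2A-I_{\mathcal R(P)}$ is invertible and, with $f(t)=1$ for $t\ge 1$, $f(t)=-1$ for $t\le 0$ (so that $f$ is defined and continuous on the spectrum of $A$), and $$B=A(2A-I_{\mathcal R(P)})^{-1},\qquad U_1=Uf(A),\qquad Q_1=I_{\mathcal N(P)}-U_1U_1^*-Q_0,$$ the following hold: $B$ is a positive contraction; $U_1$ is a partial isometry with $\mathcal R(U_1^*)=\overline{\mathcal R(B(I_{\mathcal R(P)}-B))}$ and $U_1^*Q_0=0$; $Q_1$ is a projection with $U_1^*Q_1=0$; and $$U_PP_{\mathcal N(Q)}U_P^*=\begin{pmatrix}I_{\mathcal R(P)}-B&B^{1/2}(I_{\mathcal R(P)}-B)^{1/2}U_1^*\\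 U_1B^{1/2}(I_{\mathcal R(P)}-B)^{1/2}&U_1BU_1^*+Q_1\end{pmatrix}.$$ -/

import Mathlib

set_option linter.unusedSectionVars false

noncomputable section

namespace HilbertCStar

/-! ### Adjointable operators between Hilbert `C⋆`-modules -/

/-- `Adjointable 𝔄 E F` is the set `𝓛(E, F)` of adjointable operators between the Hilbert
`𝔄`-modules `E` and `F`: maps `T : E → F` that have an adjoint `T† : F → E`. Linearity over `ℂ` and
over `𝔄` and boundedness are automatic. -/
structure Adjointable (𝔄 E F : Type*) [Inner 𝔄 E] [Inner 𝔄 F] where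
  toFun : E → F
  adjFun : F → E
  inner_adj' : ∀ x y, inner 𝔄 (toFun x) y = inner 𝔄 x (adjFun y)

variable {𝔄 E F G : Type*} [NonUnitalCStarAlgebra 𝔄] [PartialOrder 𝔄] [StarOrderedRing 𝔄]
variable [NormedAddCommGroup E] [NormedSpace ℂ E] [SMul 𝔄 E] [CStarModule 𝔄 E]
variable [NormedAddCommGroup F] [NormedSpace ℂ F] [SMul 𝔄 F] [CStarModule 𝔄 F]
variable [NormedAddCommGroup G] [NormedSpace ℂ G] [SMul 𝔄 G] [CStarModule 𝔄 G]

variable (𝔄) in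
theorem ext_inner {x y : E} (h : ∀ z : E, inner 𝔄 z x = inner 𝔄 z y) : x = y := by
  have h1 : inner 𝔄 (x - y) (x - y) = 0 := by
    rw [CStarModule.inner_sub_right, h, sub_self]
  exact sub_eq_zero.mp (CStarModule.inner_self.mp h1)

variable (𝔄) in
theorem ext_inner' {x y : E} (h : ∀ z : E, inner 𝔄 x z = inner 𝔄 y z) : x = y := by
  apply ext_inner 𝔄
  intro z
  rw [← CStarModule.star_inner x z, h, CStarModule.star_inner]

theorem smul_add_self (a : 𝔄) (x y : E) : a • (x + y) = a • x + a • y := by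
  apply ext_inner 𝔄
  intro z
  simp [mul_add]

theorem smul_zero_self (a : 𝔄) : a • (0 : E) = 0 := by
  apply ext_inner 𝔄
  intro z
  simp

namespace Adjointable

instance : FunLike (Adjointable 𝔄 E F) E F where
  coe := toFun
  coe_injective := by
    rintro ⟨f, f', hf⟩ ⟨g, g', hg⟩ h
    obtain rfl : f = g := h
    have : f' = g' := by
      funext y
      apply ext_inner 𝔄
      intro z
      rw [← hf, hg]
    subst this
    rfl

@[ext] theorem ext {S T : Adjointable 𝔄 E F} (h : ∀ x, S x = T x) : S = T :=
  DFunLike.ext _ _ h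

/-- The adjoint `T† ∈ 𝓛(F, E)` of `T ∈ 𝓛(E, F)`. -/
def adjoint (T : Adjointable 𝔄 E F) : Adjointable 𝔄 F E where
  toFun := T.adjFun
  adjFun := T.toFun
  inner_adj' x y := by
    rw [← CStarModule.star_inner, ← T.inner_adj', CStarModule.star_inner]

postfix:max "†" => Adjointable.adjoint

theorem inner_left (T : Adjointable 𝔄 E F) (x : E) (y : F) :
    inner 𝔄 (T x) y = inner 𝔄 x (T† y) := T.inner_adj' x y

theorem inner_right (T : Adjointable 𝔄 E F) (x : E) (y : F) :
    inner 𝔄 y (T x) = inner 𝔄 (T† y) x := ((T†).inner_adj' y x).symm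

@[simp] theorem adjoint_adjoint (T : Adjointable 𝔄 E F) : T†† = T := rfl

instance : LinearMapClass (Adjointable 𝔄 E F) ℂ E F where
  map_add T x y := by
    apply ext_inner 𝔄
    intro z
    simp [inner_right]
  map_smulₛₗ T c x := by
    apply ext_inner 𝔄
    intro z
    simp [inner_right]

/-- Adjointable operators are `𝔄`-linear. -/
theorem map_cstar_smul (T : Adjointable 𝔄 E F) (a : 𝔄) (x : E) : T (a • x) = a • T x := by
  apply ext_inner 𝔄
  intro z
  simp [inner_right]

/-- Composition of adjointable operators. -/
def comp (S : Adjointable 𝔄 F G) (T : Adjointable 𝔄 E F) : Adjointable 𝔄 E G where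
  toFun x := S (T x)
  adjFun y := T† (S† y)
  inner_adj' x y := by rw [inner_left, inner_left]

infixr:80 " ⊚ " => Adjointable.comp

@[simp] protected theorem comp_apply (S : Adjointable 𝔄 F G) (T : Adjointable 𝔄 E F) (x : E) :
    (S ⊚ T) x = S (T x) := rfl

/-! The vector space `𝓛(E, F)`, with the pointwise operations. -/

instance : Zero (Adjointable 𝔄 E F) := ⟨⟨fun _ => 0, fun _ => 0, by simp⟩⟩
instance : Add (Adjointable 𝔄 E F) :=
  ⟨fun S T => ⟨fun x => S x + T x, fun y => S† y + T† y, by simp [inner_left]⟩⟩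
instance : Neg (Adjointable 𝔄 E F) :=
  ⟨fun S => ⟨fun x => -S x, fun y => -S† y, by simp [inner_left]⟩⟩
instance : Sub (Adjointable 𝔄 E F) :=
  ⟨fun S T => ⟨fun x => S x - T x, fun y => S† y - T† y, by simp [inner_left]⟩⟩
instance : SMul ℂ (Adjointable 𝔄 E F) :=
  ⟨fun c S => ⟨fun x => c • S x, fun y => star c • S† y, by simp [inner_left]⟩⟩
instance : SMul ℕ (Adjointable 𝔄 E F) :=
  ⟨fun n S => ⟨fun x => n • S x, fun y => n • S† y, fun x y => by
    induction n with
    | zero => simp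
    | succ n ih => simp [add_smul, ih, inner_left]⟩⟩
instance : SMul ℤ (Adjointable 𝔄 E F) :=
  ⟨fun n S => ⟨fun x => n • S x, fun y => n • S† y, fun x y => by
    have h1 : ∀ m : ℕ, inner 𝔄 (m • S x) y = inner 𝔄 x (m • S† y) := fun m => (m • S).inner_adj' x y
    cases n with
    | ofNat m => simpa using h1 m
    | negSucc m => simpa [negSucc_zsmul] using h1 (m + 1)⟩⟩

@[simp] protected theorem zero_apply (x : E) : (0 : Adjointable 𝔄 E F) x = 0 := rfl
@[simp] protected theorem add_apply (S T : Adjointable 𝔄 E F) (x : E) : (S + T) x = S x + T x := rfl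
@[simp] protected theorem neg_apply (S : Adjointable 𝔄 E F) (x : E) : (-S) x = -S x := rfl
@[simp] protected theorem sub_apply (S T : Adjointable 𝔄 E F) (x : E) : (S - T) x = S x - T x := rfl
@[simp] protected theorem smul_apply (c : ℂ) (S : Adjointable 𝔄 E F) (x : E) : (c • S) x = c • S x := rfl

instance : AddCommGroup (Adjointable 𝔄 E F) :=
  DFunLike.coe_injective.addCommGroup (fun S : Adjointable 𝔄 E F => (S : E → F))
    rfl (fun _ _ => rfl) (fun _ => rfl) (fun _ _ => rfl) (fun _ _ => rfl) (fun _ _ => rfl)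

instance : Module ℂ (Adjointable 𝔄 E F) where
  one_smul S := by ext x; simp
  mul_smul a b S := by ext x; simp [mul_smul]
  smul_zero a := by ext x; simp
  smul_add a S T := by ext x; simp
  add_smul a b S := by ext x; simp [add_smul]
  zero_smul S := by ext x; simp

/-! The `⋆`-algebra `𝓛(E) = 𝓛(E, E)`: multiplication is composition, the star is the adjoint. -/

instance : One (Adjointable 𝔄 E E) := ⟨⟨fun x => x, fun x => x, fun _ _ => rfl⟩⟩
instance : Mul (Adjointable 𝔄 E E) := ⟨comp⟩
instance : Star (Adjointable 𝔄 E E) := ⟨adjoint⟩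

@[simp] protected theorem one_apply (x : E) : (1 : Adjointable 𝔄 E E) x = x := rfl
@[simp] protected theorem mul_apply (S T : Adjointable 𝔄 E E) (x : E) : (S * T) x = S (T x) := rfl
theorem star_eq_adjoint (S : Adjointable 𝔄 E E) : star S = S† := rfl

instance : Ring (Adjointable 𝔄 E E) :=
  { (inferInstance : AddCommGroup (Adjointable 𝔄 E E)) with
    mul_assoc := fun _ _ _ => rfl
    one_mul := fun _ => rfl
    mul_one := fun _ => rfl
    left_distrib := fun S T R => by ext x; simp
    right_distrib := fun S T R => by ext x; simp
    zero_mul := fun S => by ext x; simp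
    mul_zero := fun S => by ext x; simp }

instance : Algebra ℂ (Adjointable 𝔄 E E) :=
  Algebra.ofModule (fun c S T => by ext x; simp) (fun c S T => by ext x; simp)

instance : StarRing (Adjointable 𝔄 E E) where
  star_involutive _ := rfl
  star_mul _ _ := rfl
  star_add _ _ := rfl

instance : StarModule ℂ (Adjointable 𝔄 E E) where
  star_smul c S := by ext x; rfl

section Complete

variable [CompleteSpace E] [CompleteSpace F]

/-- Adjointable operators are bounded, by the closed graph theorem. -/
def toCLM (T : Adjointable 𝔄 E F) : E →L[ℂ] F :=
  ContinuousLinearMap.ofSeqClosedGraph (g := (T : E →ₗ[ℂ] F)) (by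
    intro u x y hu hTu
    apply ext_inner 𝔄
    intro z
    have h1 : Filter.Tendsto (fun n => inner 𝔄 z (T (u n))) Filter.atTop (nhds (inner 𝔄 z y)) :=
      (CStarModule.innerSL (A := 𝔄) z).continuous.tendsto y |>.comp hTu
    have h2 : Filter.Tendsto (fun n => inner 𝔄 (T† z) (u n)) Filter.atTop
        (nhds (inner 𝔄 (T† z) x)) :=
      (CStarModule.innerSL (A := 𝔄) (T† z)).continuous.tendsto x |>.comp hu
    simp only [inner_right] at h1
    rw [tendsto_nhds_unique h1 h2]
    exact (inner_right T x z).symm)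

@[simp] theorem toCLM_apply (T : Adjointable 𝔄 E F) (x : E) : T.toCLM x = T x := rfl

protected theorem continuous (T : Adjointable 𝔄 E F) : Continuous T := T.toCLM.continuous

variable (𝔄 E) in
/-- The inclusion of `𝓛(E)` into the bounded operators on `E`. -/
def toCLMHom : Adjointable 𝔄 E E →ₐ[ℂ] (E →L[ℂ] E) where
  toFun := toCLM
  map_one' := rfl
  map_mul' _ _ := rfl
  map_zero' := rfl
  map_add' _ _ := rfl
  commutes' _ := rfl

theorem toCLMHom_injective : Function.Injective (toCLMHom 𝔄 E) := by
  intro S T h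
  ext x
  exact congrArg (fun R : E →L[ℂ] E => R x) h

/-- `𝓛(E)` carries the operator norm. -/
instance : NormedRing (Adjointable 𝔄 E E) :=
  NormedRing.induced _ _ (toCLMHom 𝔄 E) toCLMHom_injective

instance : NormedAlgebra ℂ (Adjointable 𝔄 E E) :=
  NormedAlgebra.induced ℂ _ _ (toCLMHom 𝔄 E)

theorem norm_def (T : Adjointable 𝔄 E E) : ‖T‖ = ‖T.toCLM‖ := rfl

theorem norm_apply_le (T : Adjointable 𝔄 E E) (x : E) : ‖T x‖ ≤ ‖T‖ * ‖x‖ :=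
  T.toCLM.le_opNorm x

theorem norm_mul_self_le_aux (T : Adjointable 𝔄 E E) : ‖T‖ * ‖T‖ ≤ ‖star T * T‖ := by
  have h : ‖T‖ ≤ √‖star T * T‖ := by
    refine T.toCLM.opNorm_le_bound (Real.sqrt_nonneg _) fun x => ?_
    have hx : ‖T.toCLM x‖ ≤ √(‖star T * T‖ * ‖x‖ ^ 2) := by
      refine Real.le_sqrt_of_sq_le ?_
      rw [toCLM_apply, CStarModule.norm_sq_eq 𝔄, inner_left]
      calc _ ≤ ‖x‖ * ‖(star T * T) x‖ := CStarModule.norm_inner_le E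
        _ ≤ ‖x‖ * (‖star T * T‖ * ‖x‖) := by gcongr; exact norm_apply_le _ _
        _ = _ := by ring
    rwa [Real.sqrt_mul (norm_nonneg _), Real.sqrt_sq (norm_nonneg x)] at hx
  calc ‖T‖ * ‖T‖ ≤ √‖star T * T‖ * √‖star T * T‖ := by gcongr
    _ = _ := Real.mul_self_sqrt (norm_nonneg _)

instance : CStarRing (Adjointable 𝔄 E E) where
  norm_mul_self_le := norm_mul_self_le_aux

instance : CompleteSpace (Adjointable 𝔄 E E) := by
  refine Metric.complete_of_cauchySeq_tendsto fun u hu => ?_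
  have hiso : ∀ S T : Adjointable 𝔄 E E, dist S.toCLM T.toCLM = dist S T := fun S T => by
    rw [dist_eq_norm, dist_eq_norm]; rfl
  have h1 : CauchySeq fun n => (u n).toCLM := by
    rw [Metric.cauchySeq_iff] at hu ⊢
    simpa only [hiso] using hu
  have h2 : CauchySeq fun n => (star (u n)).toCLM := by
    rw [Metric.cauchySeq_iff] at hu ⊢
    simpa only [hiso, dist_eq_norm, ← star_sub, norm_star] using hu
  obtain ⟨R, hR⟩ := cauchySeq_tendsto_of_complete h1
  obtain ⟨R', hR'⟩ := cauchySeq_tendsto_of_complete h2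
  refine ⟨⟨R, R', fun x y => ?_⟩, ?_⟩
  · have a1 : Filter.Tendsto (fun n => inner 𝔄 y (u n x)) Filter.atTop (nhds (inner 𝔄 y (R x))) :=
      (CStarModule.innerSL (A := 𝔄) y).continuous.tendsto _ |>.comp
        ((ContinuousLinearMap.apply ℂ E x).continuous.tendsto _ |>.comp hR)
    have a2 : Filter.Tendsto (fun n => inner 𝔄 x (star (u n) y)) Filter.atTop
        (nhds (inner 𝔄 x (R' y))) :=
      (CStarModule.innerSL (A := 𝔄) x).continuous.tendsto _ |>.comp
        ((ContinuousLinearMap.apply ℂ E y).continuous.tendsto _ |>.comp hR')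
    have a3 := a1.star
    simp only [CStarModule.star_inner, inner_left] at a3
    exact tendsto_nhds_unique a3 a2
  · rw [tendsto_iff_dist_tendsto_zero] at hR ⊢
    refine hR.congr fun n => ?_
    rw [← hiso]; rfl

/-- The adjointable operators on a Hilbert `C⋆`-module form a `C⋆`-algebra. -/
instance : CStarAlgebra (Adjointable 𝔄 E E) where

/-- `T ≥ 0` means that `T` is a positive element of the `C⋆`-algebra `𝓛(E)`. -/
instance : PartialOrder (Adjointable 𝔄 E E) := CStarAlgebra.spectralOrder _

instance : StarOrderedRing (Adjointable 𝔄 E E) := CStarAlgebra.spectralOrderedRing _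

end Complete

/-- `U ∈ 𝓛(E, F)` is a partial isometry. -/
def IsPartialIsometry (U : Adjointable 𝔄 E F) : Prop := U ⊚ U† ⊚ U = U

end Adjointable

/-! ### Closed submodules, orthogonal complements and projections -/

variable (𝔄 E) in
/-- A closed submodule of a Hilbert `𝔄`-module. -/
structure ClosedSub extends Submodule ℂ E where
  cstar_smul_mem' : ∀ (a : 𝔄) {x : E}, x ∈ carrier → a • x ∈ carrier
  isClosed' : IsClosed carrier

namespace ClosedSub

/-- The type of elements of `M`. -/
def Elem (M : ClosedSub 𝔄 E) : Type _ := {x : E // x ∈ M.toSubmodule}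

instance : CoeSort (ClosedSub 𝔄 E) (Type _) := ⟨Elem⟩

/-- The underlying vector of an element of `M`. -/
def Elem.val {M : ClosedSub 𝔄 E} (x : M) : E := Subtype.val x

/-- Regard a vector in `M` as an element of `M`. -/
def Elem.mk {M : ClosedSub 𝔄 E} (x : E) (hx : x ∈ M.toSubmodule) : M := Subtype.mk x hx

theorem Elem.mem {M : ClosedSub 𝔄 E} (x : M) : x.val ∈ M.toSubmodule := Subtype.property x

@[simp] theorem Elem.val_mk {M : ClosedSub 𝔄 E} (x : E) (hx : x ∈ M.toSubmodule) :
    (Elem.mk x hx).val = x := rfl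

@[ext] theorem Elem.ext {M : ClosedSub 𝔄 E} {x y : M} (h : x.val = y.val) : x = y :=
  Subtype.ext h

instance : Membership E (ClosedSub 𝔄 E) := ⟨fun M x => x ∈ M.toSubmodule⟩

/-! A closed submodule is a Hilbert `𝔄`-module with the restricted structure. -/

instance (M : ClosedSub 𝔄 E) : NormedAddCommGroup M :=
  inferInstanceAs (NormedAddCommGroup M.toSubmodule)

instance (M : ClosedSub 𝔄 E) : NormedSpace ℂ M := inferInstanceAs (NormedSpace ℂ M.toSubmodule)

instance (M : ClosedSub 𝔄 E) : SMul 𝔄 M := 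
  ⟨fun a x => Elem.mk (a • x.val) (M.cstar_smul_mem' a x.mem)⟩

instance (M : ClosedSub 𝔄 E) : CStarModule 𝔄 M where
  inner x y := inner 𝔄 x.val y.val
  inner_add_right := CStarModule.inner_add_right
  inner_self_nonneg := CStarModule.inner_self_nonneg
  inner_self {x} := CStarModule.inner_self.trans (ZeroMemClass.coe_eq_zero (S' := M.toSubmodule) (x := x))
  inner_op_smul_right := CStarModule.inner_op_smul_right
  inner_smul_right_complex := CStarModule.inner_smul_right_complex
  star_inner _ _ := CStarModule.star_inner _ _
  norm_eq_sqrt_norm_inner_self x := CStarModule.norm_eq_sqrt_norm_inner_self (A := 𝔄) x.val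

@[simp] theorem Elem.val_add {M : ClosedSub 𝔄 E} (x y : M) : (x + y).val = x.val + y.val := rfl

@[simp] theorem Elem.val_complex_smul {M : ClosedSub 𝔄 E} (c : ℂ) (x : M) :
    (c • x).val = c • x.val := rfl

theorem Elem.norm_val {M : ClosedSub 𝔄 E} (x : M) : ‖x.val‖ = ‖x‖ := rfl

theorem inner_coe (M : ClosedSub 𝔄 E) (x y : M) : inner 𝔄 x y = inner 𝔄 x.val y.val := rfl

instance [CompleteSpace E] (M : ClosedSub 𝔄 E) : CompleteSpace M :=
  M.isClosed'.completeSpace_coe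

/-- The orthogonal complement `M^⊥`, as a subset of `E`. -/
def orth (M : ClosedSub 𝔄 E) : Set E := {x | ∀ y ∈ M, inner 𝔄 x y = 0}

/-- `M` is orthogonally complemented in `E`: `E = M + M^⊥`. -/
def IsOrthComplemented (M : ClosedSub 𝔄 E) : Prop :=
  ∀ x : E, ∃ y ∈ M, ∃ z ∈ M.orth, x = y + z

theorem orth_swap {M : ClosedSub 𝔄 E} {x y : E} (hx : x ∈ M.orth) (hy : y ∈ M) :
    inner 𝔄 y x = 0 := by
  rw [← CStarModule.star_inner, hx y hy, star_zero]

/-- The projection `P_M ∈ 𝓛(E)` onto the orthogonally complemented closed submodule `M`: it maps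
`x` to the component in `M` of the decomposition `E = M + M^⊥`. -/
def proj (M : ClosedSub 𝔄 E) (h : M.IsOrthComplemented) : Adjointable 𝔄 E E where
  toFun x := (h x).choose
  adjFun x := (h x).choose
  inner_adj' x y := by
    obtain ⟨hx, z, hz, hxz⟩ := (h x).choose_spec
    obtain ⟨hy, w, hw, hyw⟩ := (h y).choose_spec
    have h1 : inner 𝔄 (h x).choose y = inner 𝔄 (h x).choose (h y).choose := by
      conv_lhs => rw [hyw]
      rw [CStarModule.inner_add_right, orth_swap hw hx, add_zero]
    have h2 : inner 𝔄 x (h y).choose = inner 𝔄 (h x).choose (h y).choose := by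
      conv_lhs => rw [hxz]
      rw [CStarModule.inner_add_left, hz _ hy, add_zero]
    rw [h1, h2]

/-- `P_M x` is characterised by `P_M x ∈ M` and `x - P_M x ∈ M^⊥`. -/
theorem proj_spec (M : ClosedSub 𝔄 E) (h : M.IsOrthComplemented) (x : E) :
    M.proj h x ∈ M ∧ x - M.proj h x ∈ M.orth := by
  obtain ⟨hx, z, hz, hxz⟩ := (h x).choose_spec
  refine ⟨hx, ?_⟩
  have : x - M.proj h x = z := by
    rw [sub_eq_iff_eq_add']; exact hxz
  rwa [this]

end ClosedSub

namespace Adjointable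

variable [CompleteSpace E] [CompleteSpace F]

/-- The null space `𝓝(T)`. -/
def ker (T : Adjointable 𝔄 E F) : ClosedSub 𝔄 E where
  carrier := {x | T x = 0}
  zero_mem' := map_zero T
  add_mem' {x y} hx hy := by
    change T (x + y) = 0
    rw [map_add, show T x = 0 from hx, show T y = 0 from hy, add_zero]
  smul_mem' c x hx := by
    change T (c • x) = 0
    rw [map_smul, show T x = 0 from hx, smul_zero]
  cstar_smul_mem' a x hx := by
    change T (a • x) = 0
    rw [map_cstar_smul, show T x = 0 from hx, smul_zero_self]
  isClosed' := isClosed_eq T.continuous continuous_const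

/-- The range `𝓡(P)` of a projection (it is closed). -/
def range (P : Adjointable 𝔄 E E) (hP : IsStarProjection P) : ClosedSub 𝔄 E where
  carrier := Set.range P
  zero_mem' := ⟨0, map_zero P⟩
  add_mem' := by
    rintro _ _ ⟨x, rfl⟩ ⟨y, rfl⟩
    exact ⟨x + y, map_add P x y⟩
  smul_mem' := by
    rintro c _ ⟨x, rfl⟩
    exact ⟨c • x, map_smul P c x⟩
  cstar_smul_mem' := by
    rintro a _ ⟨x, rfl⟩
    exact ⟨a • x, map_cstar_smul P a x⟩
  isClosed' := by
    have : Set.range P = {x | P x = x} := by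
      ext y
      constructor
      · rintro ⟨x, rfl⟩
        exact congrArg (fun R : Adjointable 𝔄 E E => R x) hP.isIdempotentElem.eq
      · exact fun h => ⟨y, h⟩
    rw [this]
    exact isClosed_eq P.continuous continuous_id

theorem mem_ker {T : Adjointable 𝔄 E F} {x : E} : x ∈ T.ker.toSubmodule ↔ T x = 0 := Iff.rfl

theorem mem_range {P : Adjointable 𝔄 E E} {hP : IsStarProjection P} {x : E} :
    x ∈ (P.range hP).toSubmodule ↔ ∃ y, P y = x := Iff.rfl

theorem mem_range_self (P : Adjointable 𝔄 E E) (hP : IsStarProjection P) (x : E) :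
    P x ∈ (P.range hP).toSubmodule := mem_range.2 ⟨x, rfl⟩

theorem compl_mem_ker (P : Adjointable 𝔄 E E) (hP : IsStarProjection P) (x : E) :
    (1 - P) x ∈ P.ker.toSubmodule := by
  rw [mem_ker, ← Adjointable.mul_apply, mul_sub, mul_one, hP.isIdempotentElem.eq, sub_self,
    Adjointable.zero_apply]

/-- The closure of the range of `T`. -/
def rangeClosure (T : Adjointable 𝔄 E F) : ClosedSub 𝔄 F where
  __ := (LinearMap.range (T : E →ₗ[ℂ] F)).topologicalClosure
  cstar_smul_mem' a x hx := by
    have hc : Continuous fun y : F => a • y := by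
      let L : F →L[ℂ] F := LinearMap.mkContinuous
        { toFun := fun y => a • y
          map_add' := smul_add_self a
          map_smul' := fun c y => by
            apply ext_inner 𝔄
            intro z
            simp [mul_smul_comm] } ‖a‖ (fun y => by
          refine abs_le_of_sq_le_sq' ?_ (by positivity) |>.2
          simp only [LinearMap.coe_mk, AddHom.coe_mk]
          rw [mul_pow, CStarModule.norm_sq_eq 𝔄 (x := a • y), CStarModule.norm_sq_eq 𝔄 (x := y)]
          simp only [CStarModule.inner_op_smul_right, CStarModule.inner_op_smul_left]
          calc ‖a * (inner 𝔄 y y * star a)‖ ≤ ‖a‖ * (‖inner 𝔄 y y‖ * ‖star a‖) :=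
                (norm_mul_le _ _).trans (by gcongr; exact norm_mul_le _ _)
            _ = _ := by rw [norm_star]; ring)
      exact L.continuous
    refine map_mem_closure hc hx ?_
    rintro _ ⟨y, rfl⟩
    exact ⟨a • y, map_cstar_smul T a y⟩
  isClosed' := isClosed_closure

theorem coe_rangeClosure (T : Adjointable 𝔄 E F) :
    (T.rangeClosure.carrier : Set F) = closure (Set.range T) := rfl

end Adjointable

/-! ### Quasi-projection pairs -/

open Adjointable

section Pairs

variable [CompleteSpace E]

/-- `(P, Q)` is a quasi-projection pair on `E`. -/
structure IsQuasiProjectionPair (P Q : Adjointable 𝔄 E E) : Prop where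
  isStarProjection : IsStarProjection P
  isIdempotentElem : IsIdempotentElem Q
  eq₁₁ : P * star Q * P = P * Q * P
  eq₁₂ : P * star Q * (1 - P) = -(P * Q * (1 - P))
  eq₂₂ : (1 - P) * star Q * (1 - P) = (1 - P) * Q * (1 - P)

/-- The quasi-projection pair `(P, Q)` is harmonious: the closures of the ranges of `P Q (1 - P)`
and `(1 - P) Q P` are orthogonally complemented. -/
structure IsHarmonious (P Q : Adjointable 𝔄 E E) : Prop extends IsQuasiProjectionPair P Q where
  complemented₅ : (rangeClosure (P * Q * (1 - P))).IsOrthComplemented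
  complemented₆ : (rangeClosure ((1 - P) * Q * P)).IsOrthComplemented

end Pairs

/-! ### Operator matrices -/

open scoped WithCStarModule

section Blocks

variable [CompleteSpace E] [CompleteSpace F]

/-- The operator matrix `(a b; c d)` on the direct sum `E ⊕ F`. -/
def block (a : Adjointable 𝔄 E E) (b : Adjointable 𝔄 F E) (c : Adjointable 𝔄 E F)
    (d : Adjointable 𝔄 F F) : Adjointable 𝔄 C⋆ᵐᵒᵈ(𝔄, E × F) C⋆ᵐᵒᵈ(𝔄, E × F) where
  toFun x := (WithCStarModule.equiv 𝔄 (E × F)).symm (a x.1 + b x.2, c x.1 + d x.2)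
  adjFun x := (WithCStarModule.equiv 𝔄 (E × F)).symm (a† x.1 + c† x.2, b† x.1 + d† x.2)
  inner_adj' x y := by
    simp only [WithCStarModule.prod_inner, WithCStarModule.equiv_symm_fst,
      WithCStarModule.equiv_symm_snd, CStarModule.inner_add_left, CStarModule.inner_add_right,
      inner_left]
    abel

/-- The unitary `U_P : E → 𝓡(P) ⊕ 𝓝(P)`, `x ↦ (P x, (1 - P) x)`, of a projection `P`; its adjoint
is `(x₁, x₂) ↦ x₁ + x₂`. -/
def splitting (P : Adjointable 𝔄 E E) (hP : IsStarProjection P) :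
    Adjointable 𝔄 E C⋆ᵐᵒᵈ(𝔄, range P hP × ker P) where
  toFun x := (WithCStarModule.equiv 𝔄 (range P hP × ker P)).symm
    (.mk (P x) (mem_range_self P hP x), .mk ((1 - P) x) (compl_mem_ker P hP x))
  adjFun x := x.1.val + x.2.val
  inner_adj' x y := by
    have hs : P† = P := hP.isSelfAdjoint
    have hz : P y.1.val = y.1.val := by
      obtain ⟨z, hz⟩ := mem_range.1 y.1.mem
      rw [← hz, ← Adjointable.mul_apply, hP.isIdempotentElem.eq]
    have hw : P y.2.val = 0 := mem_ker.1 y.2.mem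
    simp only [WithCStarModule.prod_inner, WithCStarModule.equiv_symm_fst,
      WithCStarModule.equiv_symm_snd, ClosedSub.inner_coe, ClosedSub.Elem.val_mk, CStarModule.inner_add_right,
      Adjointable.sub_apply, Adjointable.one_apply, CStarModule.inner_sub_left, inner_left, hs,
      hz, hw]
    simp

end Blocks

/-! ### The canonical `2 × 2` representation -/

section Canonical

variable [CompleteSpace E]

/-- `ℓ(A) = (A² - A)^{1/2}`, for a self-adjoint `A` with `A² - A ≥ 0`. -/
def ell (A : Adjointable 𝔄 E E) : Adjointable 𝔄 E E := CFC.sqrt (A ^ 2 - A)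

/-- The function `f` with value `1` on `[1, ∞)` and `-1` on `(-∞, 0]`. Its values on `(0, 1)` play
no role: it is only applied to operators whose spectrum does not meet that interval. -/
def signFun (t : ℝ) : ℝ := if 1 ≤ t then 1 else -1

/-- `A`, `U`, `Q₀` are the entries of a canonical `2 × 2` block matrix representation of `Q` induced
by the projection `P`. -/
structure IsCanonicalRep (P : Adjointable 𝔄 E E) (hP : IsStarProjection P)
    (Q : Adjointable 𝔄 E E) (A : Adjointable 𝔄 (range P hP) (range P hP))
    (U : Adjointable 𝔄 (range P hP) (ker P)) (Q₀ : Adjointable 𝔄 (ker P) (ker P)) : Prop where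
  isSelfAdjoint : IsSelfAdjoint A
  nonneg : 0 ≤ A ^ 2 - A
  isPartialIsometry : IsPartialIsometry U
  isStarProjection : IsStarProjection Q₀
  range_adjoint : Set.range U† = closure (Set.range ⇑(A ^ 2 - A))
  adjoint_comp : U† ⊚ Q₀ = 0
  block_eq : splitting P hP ⊚ Q ⊚ (splitting P hP)† =
    block A (-(ell A ⊚ U†)) (U ⊚ ell A) (U ⊚ (1 - A) ⊚ U† + Q₀)

end Canonical

end HilbertCStar

end

noncomputable section

/-! The projection `N` onto the kernel of an idempotent `q` solves one linear equation. Since `N (1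
- q) = 1 - q` and `q N = 0`, hence `N q⋆ = 0`, it satisfies `N (1 - q - q⋆) = 1 - q`, where `1 - q -
q⋆` is invertible (`isUnit_one_sub_sub_star`). Conversely, a self-adjoint solution must be that
projection (`mul_eq_zero_and_mul_one_sub`, `exists_isOrthComplemented_ker`). So both the
complementability of `𝓝(Q)` and the formula follow once the claimed matrix is seen to be a
self-adjoint solution.

In the coordinates given by `P`, the off-diagonal entries of `Q` and `Q⋆` cancel, so `1 - Q - Q⋆` is
block diagonal. The check (`block_comp_one_sub_sub_adjoint`) then reduces to relations between
functions of `A`. Because `A² - A ≥ 0`, the spectrum of `A` avoids `(0, 1)`; thus `2A - 1` is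
invertible and `f(A)`, the sign of `2A - 1`, is a continuous function of `A`. The relations are
collected in `gapCalculus`.

A canonical representation comes from the polar decomposition of the corner `C` of `Q` from `𝓡(P)`
to `𝓝(P)`. Idempotency gives `A² - A = C† C`, so `ℓ(A)` is the modulus of `C`, and harmoniousness
supplies the complemented ranges that the decomposition needs (`exists_polar_decomposition`). The
part of the lower right corner not accounted for by `U (1 - A) U†` is the projection `Q₀`
(`exists_canonical_entries`). -/

namespace HilbertCStar

/-! ### Idempotents in a `C⋆`-algebra. -/

section CStarAlgebra

variable {R : Type*} [CStarAlgebra R] [PartialOrder R] [StarOrderedRing R]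

/-- If `q` is an idempotent, then `1 - q - q⋆` is invertible. -/
theorem isUnit_one_sub_sub_star {q : R} (hq : IsIdempotentElem q) : IsUnit (1 - q - star q) := by
  have hs : star q * star q = star q := by rw [← star_mul, hq.eq]
  have h1 : (1 : R) ≤ (1 - q - star q) ^ 2 := by
    -- The skew-adjoint element `q - q⋆` measures how far `q` is from being a projection; it makes
    -- the square at least `1`.
    have h2 : (1 - q - star q) ^ 2 = 1 + (q - star q) * star (q - star q) := by
      simp only [pow_two, sub_mul, mul_sub, mul_one, one_mul, hq.eq, hs, star_sub, star_star]
      abel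
    rw [h2]
    exact le_add_of_nonneg_right (mul_star_self_nonneg _)
  exact (isUnit_pow_iff two_ne_zero).1 (CStarAlgebra.isUnit_of_le 1 h1)

/-- A self-adjoint `y` with `y (1 - q - q⋆) = 1 - q` satisfies `q y = 0` and `y (1 - q) = 1 - q`;
it is the projection onto the kernel of the idempotent `q`. -/
theorem mul_eq_zero_and_mul_one_sub {q y : R} (hq : IsIdempotentElem q) (hy : IsSelfAdjoint y)
    (h : y * (1 - q - star q) = 1 - q) : q * y = 0 ∧ y * (1 - q) = 1 - q := by
  obtain ⟨u, hu⟩ := isUnit_one_sub_sub_star hq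
  have hs : star q * star q = star q := by rw [← star_mul, hq.eq]
  have h' : (1 - q - star q) * y = 1 - star q := by
    have := congrArg star h
    simp only [star_mul, star_sub, star_one, star_star, hy.star_eq] at this
    rw [← this]; congr 1; abel
  -- Both sides equal `-q⋆ q`. This moves `q` past the unit, so that each claim can be tested after
  -- multiplying by it on the left.
  have hqT : star q * (1 - q - star q) = (1 - q - star q) * q := by
    simp only [sub_mul, mul_sub, mul_one, one_mul, hq.eq, hs]
    abel
  rw [← hu] at h h' hqT
  constructor
  · rw [← u.mul_right_eq_zero, ← mul_assoc, ← hqT, mul_assoc, h', mul_sub, hs, mul_one, sub_self]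
  · rw [← u.mul_right_inj, ← mul_assoc, h', hu]
    simp only [sub_mul, mul_sub, mul_one, one_mul, hq.eq]
    abel

/-! ### Functional calculus when the spectrum avoids `(0, 1)`. -/

section Gap

variable {A : R}

/-- Positivity of `A² - A` means `t² - t ≥ 0` on the spectrum, and this fails exactly on `(0, 1)`.
-/
theorem spectrum_gap (hA : IsSelfAdjoint A) (h : 0 ≤ A ^ 2 - A) {t : ℝ}
    (ht : t ∈ spectrum ℝ A) : t ≤ 0 ∨ 1 ≤ t := by
  have h1 : cfc (fun t : ℝ => t ^ 2 - t) A = A ^ 2 - A := by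
    rw [cfc_sub _ _ A, cfc_pow _ _ A, cfc_id' ℝ A]
  rw [← h1, cfc_nonneg_iff _ _] at h
  have h2 := h t ht
  by_contra! hc
  nlinarith

/-- The function is constant on each of the disjoint closed sets `(-∞, 0]` and `[1, ∞)`, whose union
contains the spectrum. -/
theorem continuousOn_signFun (hA : IsSelfAdjoint A) (h : 0 ≤ A ^ 2 - A) :
    ContinuousOn signFun (spectrum ℝ A) := by
  have h1 : ContinuousOn signFun (Set.Iic 0 ∪ Set.Ici 1) := by
    refine ContinuousOn.union_of_isClosed ?_ ?_ isClosed_Iic isClosed_Ici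
    · refine (continuousOn_const (c := (-1 : ℝ))).congr fun t ht => ?_
      have : t ≤ 0 := ht
      simp only [signFun]; rw [if_neg (by linarith)]
    · refine (continuousOn_const (c := (1 : ℝ))).congr fun t ht => ?_
      have : 1 ≤ t := ht
      simp only [signFun]; rw [if_pos this]
  exact h1.mono fun t ht => spectrum_gap hA h ht

theorem two_mul_sub_one_ne_zero {t : ℝ} (ht : t ≤ 0 ∨ 1 ≤ t) : 2 * t - 1 ≠ 0 := by
  intro h0
  rcases ht with h | h <;> linarith

theorem continuousOn_inv_two_mul_sub_one (hA : IsSelfAdjoint A) (h : 0 ≤ A ^ 2 - A) :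
    ContinuousOn (fun t : ℝ => (2 * t - 1)⁻¹) (spectrum ℝ A) :=
  ContinuousOn.inv₀ (by fun_prop) fun _ ht => two_mul_sub_one_ne_zero (spectrum_gap hA h ht)

theorem cfc_two_mul_sub_one (hA : IsSelfAdjoint A) :
    cfc (fun t : ℝ => 2 * t - 1) A = 2 * A - 1 := by
  rw [cfc_sub _ _ A, cfc_const_one ℝ A, cfc_const_mul _ _ A, cfc_id' ℝ A, two_smul, two_mul]

theorem cfc_inv_mul_cancel (hA : IsSelfAdjoint A) (h : 0 ≤ A ^ 2 - A) :
    cfc (fun t : ℝ => (2 * t - 1)⁻¹) A * (2 * A - 1) = 1 := by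
  have hc := continuousOn_inv_two_mul_sub_one hA h
  rw [← cfc_two_mul_sub_one hA, ← cfc_mul _ _ A hc (by fun_prop), ← cfc_const_one ℝ A]
  exact cfc_congr fun t ht => inv_mul_cancel₀ (two_mul_sub_one_ne_zero (spectrum_gap hA h ht))

theorem isUnit_two_mul_sub_one (hA : IsSelfAdjoint A) (h : 0 ≤ A ^ 2 - A) :
    IsUnit (2 * A - 1) := by
  have h1 := cfc_inv_mul_cancel hA h
  have h2 : Commute (2 * A - 1) A := by
    simp [Commute, SemiconjBy, sub_mul, mul_sub, two_mul, add_mul, mul_add]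
  have h3 := (h2.symm.cfc_real (fun t : ℝ => (2 * t - 1)⁻¹)).eq
  exact ⟨⟨2 * A - 1, _, h3 ▸ h1, h1⟩, rfl⟩

/-- `A (2 A - 1)⁻¹` in terms of the functional calculus. -/
theorem mul_inverse_eq_cfc (hA : IsSelfAdjoint A) (h : 0 ≤ A ^ 2 - A) :
    A * Ring.inverse (2 * A - 1) = cfc (fun t : ℝ => t * (2 * t - 1)⁻¹) A := by
  have hc := continuousOn_inv_two_mul_sub_one hA h
  symm
  rw [Ring.eq_mul_inverse_iff_mul_eq _ _ _ (isUnit_two_mul_sub_one hA h),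
    cfc_mul _ _ A (by fun_prop) hc, cfc_id' ℝ A, mul_assoc, cfc_inv_mul_cancel hA h, mul_one]

theorem cfc_sqrt_eq {g : ℝ → ℝ} (hg : ContinuousOn g (spectrum ℝ A))
    (h0 : ∀ t ∈ spectrum ℝ A, 0 ≤ g t) : CFC.sqrt (cfc g A) = cfc (fun t => √(g t)) A := by
  refine CFC.sqrt_unique ?_ (cfc_nonneg fun t _ => Real.sqrt_nonneg _)
  rw [← cfc_mul _ _ A hg.sqrt hg.sqrt]
  exact cfc_congr fun t ht => Real.mul_self_sqrt (h0 t ht)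

/-- The algebraic relations between `A`, `B = A (2 A - 1)⁻¹`, `(A² - A)^{1/2}` and `f(A)`. -/
structure GapCalculus (A B L F : R) : Prop where
  nonneg : 0 ≤ B
  le_one : B ≤ 1
  mul_two_sub : B * (2 * A - 1) = A
  sign_mul_sign : F * F = 1
  isSelfAdjoint_sign : IsSelfAdjoint F
  sqrt_mul_two_sub : CFC.sqrt B * CFC.sqrt (1 - B) * (2 * A - 1) = L * F
  commute : Commute F (CFC.sqrt B * CFC.sqrt (1 - B))
  isSelfAdjoint_sqrt : IsSelfAdjoint (CFC.sqrt B * CFC.sqrt (1 - B))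
  mul_one_sub : B * (1 - B) * (2 * A - 1) ^ 2 = A ^ 2 - A
  of_commute : ∀ p, Commute A p → Commute F p ∧ Commute B p ∧ Commute L p

/-- The analytic relations are identities of real functions on the spectrum, with `b(t) = t / (2t -
1)` and `1 - b(t) = (t - 1) / (2t - 1)`. Outside `(0, 1)` neither numerator has sign opposite to `2t
- 1`, whence `0 ≤ b ≤ 1`. -/
theorem gapCalculus (hA : IsSelfAdjoint A) (h : 0 ≤ A ^ 2 - A) :
    GapCalculus A (A * Ring.inverse (2 * A - 1)) (CFC.sqrt (A ^ 2 - A)) (cfc signFun A) := by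
  have hgap := fun t ht => spectrum_gap (t := t) hA h ht
  have hne := fun t ht => two_mul_sub_one_ne_zero (hgap t ht)
  have hc := continuousOn_inv_two_mul_sub_one hA h
  have hs := continuousOn_signFun hA h
  have hB := mul_inverse_eq_cfc hA h
  have hbc : ContinuousOn (fun t : ℝ => t * (2 * t - 1)⁻¹) (spectrum ℝ A) :=
    continuousOn_id.mul hc
  have hBc : ContinuousOn (fun t : ℝ => 1 - t * (2 * t - 1)⁻¹) (spectrum ℝ A) :=
    continuousOn_const.sub hbc
  have hb0 : ∀ t ∈ spectrum ℝ A, 0 ≤ t * (2 * t - 1)⁻¹ := fun t ht => by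
    rcases hgap t ht with h1 | h1
    · exact mul_nonneg_of_nonpos_of_nonpos h1 (inv_nonpos.2 (by linarith))
    · exact mul_nonneg (by linarith) (inv_nonneg.2 (by linarith))
  have hb1' : ∀ t ∈ spectrum ℝ A, 1 - t * (2 * t - 1)⁻¹ = (t - 1) * (2 * t - 1)⁻¹ :=
    fun t ht => by
      have h2 := mul_inv_cancel₀ (hne t ht)
      linear_combination -h2
  have hb1 : ∀ t ∈ spectrum ℝ A, 0 ≤ 1 - t * (2 * t - 1)⁻¹ := fun t ht => by
    rw [hb1' t ht]
    rcases hgap t ht with h1 | h1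
    · exact mul_nonneg_of_nonpos_of_nonpos (by linarith) (inv_nonpos.2 (by linarith))
    · exact mul_nonneg (by linarith) (inv_nonneg.2 (by linarith))
  have h1B : 1 - A * Ring.inverse (2 * A - 1) = cfc (fun t : ℝ => 1 - t * (2 * t - 1)⁻¹) A := by
    rw [cfc_sub _ _ A (by fun_prop) hbc, hB, cfc_const_one ℝ A]
  have hAA : A ^ 2 - A = cfc (fun t : ℝ => t ^ 2 - t) A := by
    rw [cfc_sub _ _ A, cfc_pow _ _ A, cfc_id' ℝ A]
  have hAA0 : ∀ t ∈ spectrum ℝ A, 0 ≤ t ^ 2 - t := fun t ht => by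
    rcases hgap t ht with h1 | h1 <;> nlinarith
  have hKc : ContinuousOn (fun t : ℝ => √(t * (2 * t - 1)⁻¹) * √(1 - t * (2 * t - 1)⁻¹))
      (spectrum ℝ A) := hbc.sqrt.mul hBc.sqrt
  have hBm : A * Ring.inverse (2 * A - 1) * (2 * A - 1) = A := by
    rw [mul_assoc, Ring.inverse_mul_cancel _ (isUnit_two_mul_sub_one hA h), mul_one]
  have hsB : CFC.sqrt (A * Ring.inverse (2 * A - 1)) *
      CFC.sqrt (1 - A * Ring.inverse (2 * A - 1)) =
      cfc (fun t : ℝ => √(t * (2 * t - 1)⁻¹) * √(1 - t * (2 * t - 1)⁻¹)) A := by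
    rw [h1B, hB, cfc_sqrt_eq hbc hb0, cfc_sqrt_eq hBc hb1, cfc_mul _ _ A hbc.sqrt hBc.sqrt]
  have hA2 : Commute (2 * A - 1) A := by
    simp [Commute, SemiconjBy, sub_mul, mul_sub, two_mul, add_mul, mul_add]
  have hsa : IsSelfAdjoint (CFC.sqrt (A * Ring.inverse (2 * A - 1)) *
      CFC.sqrt (1 - A * Ring.inverse (2 * A - 1))) := hsB ▸ IsSelfAdjoint.cfc
  constructor
  · rw [hB]; exact cfc_nonneg hb0
  · rw [← sub_nonneg, h1B]; exact cfc_nonneg hb1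
  · exact hBm
  · rw [← cfc_mul _ _ A hs hs, ← cfc_const_one ℝ A]
    refine cfc_congr fun t _ => ?_
    simp only [signFun]; split_ifs <;> norm_num
  · exact IsSelfAdjoint.cfc
  -- Here `b (1 - b) = (t² - t) / (2t - 1)²`, whose root involves `|2t - 1|`. Multiplying by `2t -
  -- 1` therefore leaves the sign of `2t - 1`, which is `f(t)`.
  · rw [hsB, hAA, cfc_sqrt_eq (by fun_prop) hAA0, ← cfc_two_mul_sub_one hA,
      ← cfc_mul _ _ A hKc (by fun_prop), ← cfc_mul _ _ A (by fun_prop) hs]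
    refine cfc_congr fun t ht => ?_
    have h2 : t * (2 * t - 1)⁻¹ * ((t - 1) * (2 * t - 1)⁻¹) = (t ^ 2 - t) / (2 * t - 1) ^ 2 := by
      field_simp [hne t ht]
    simp only [signFun]
    rw [← Real.sqrt_mul (hb0 t ht), hb1' t ht, h2, Real.sqrt_div (hAA0 t ht), Real.sqrt_sq_eq_abs]
    have h3 := hne t ht
    split_ifs with h4
    · rw [abs_of_pos (by linarith), div_mul_cancel₀ _ h3, mul_one]
    · have h5 : t ≤ 0 := (hgap t ht).resolve_right h4
      rw [abs_of_neg (by linarith), div_neg, neg_mul, div_mul_cancel₀ _ h3, mul_neg_one]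
  · rw [hsB]; exact cfc_commute_cfc _ _ A
  · exact hsa
  · rw [hB]
    rw [hB] at hBm
    set b := cfc (fun t : ℝ => t * (2 * t - 1)⁻¹) A
    have hcomm : Commute (2 * A - 1) b := (hA2.symm.cfc_real _).symm
    have : (1 - b) * (2 * A - 1) = A - 1 := by rw [sub_mul, hBm, one_mul, two_mul]; abel
    rw [pow_two, ← mul_assoc, mul_assoc b, this, mul_assoc,
      (show Commute (A - 1) (2 * A - 1) from (hA2.sub_right (Commute.one_right _)).symm).eq,
      ← mul_assoc, hBm, mul_sub, mul_one, pow_two]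
  · intro p hp
    refine ⟨hp.cfc_real _, ?_, ?_⟩
    · rw [hB]; exact hp.cfc_real _
    · rw [hAA, cfc_sqrt_eq (by fun_prop) hAA0]; exact hp.cfc_real _

end Gap

/-- For `T ≥ 0` the elements `1 - T r = ε (T + ε)⁻¹` are almost annihilated by `T`. -/
theorem exists_approx_inverse {T : R} (hT : 0 ≤ T) {ε : ℝ} (hε : 0 < ε) :
    ∃ r : R, IsSelfAdjoint (1 - T * r) ∧ ‖(1 - T * r) * (T * (1 - T * r))‖ ≤ ε := by
  have hsa : IsSelfAdjoint T := .of_nonneg hT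
  have h0 : ∀ t ∈ spectrum ℝ T, 0 ≤ t := fun t ht => spectrum_nonneg_of_nonneg hT ht
  have hc : ContinuousOn (fun t : ℝ => (t + ε)⁻¹) (spectrum ℝ T) :=
    ContinuousOn.inv₀ (by fun_prop) fun t ht => by have := h0 t ht; positivity
  have hc' : ContinuousOn (fun t : ℝ => ε * (t + ε)⁻¹) (spectrum ℝ T) := continuousOn_const.mul hc
  have hci : ContinuousOn (fun t : ℝ => t * (t + ε)⁻¹) (spectrum ℝ T) := continuousOn_id.mul hc
  have hci' : ContinuousOn (fun t : ℝ => t * (ε * (t + ε)⁻¹)) (spectrum ℝ T) :=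
    continuousOn_id.mul hc'
  have h1 : 1 - T * cfc (fun t : ℝ => (t + ε)⁻¹) T = cfc (fun t : ℝ => ε * (t + ε)⁻¹) T := by
    have h2 : T * cfc (fun t : ℝ => (t + ε)⁻¹) T = cfc (fun t : ℝ => t * (t + ε)⁻¹) T := by
      rw [cfc_mul _ _ T (by fun_prop) hc, cfc_id' ℝ T]
    rw [h2, ← cfc_const_one ℝ T, ← cfc_sub _ _ T (by fun_prop) hci]
    refine cfc_congr fun t ht => ?_
    have := h0 t ht
    have : t + ε ≠ 0 := by positivity
    field_simp
    ring
  refine ⟨cfc (fun t : ℝ => (t + ε)⁻¹) T, h1 ▸ IsSelfAdjoint.cfc, ?_⟩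
  have h3 : T * cfc (fun t : ℝ => ε * (t + ε)⁻¹) T = cfc (fun t : ℝ => t * (ε * (t + ε)⁻¹)) T := by
    rw [cfc_mul _ _ T (by fun_prop) hc', cfc_id' ℝ T]
  rw [h1, h3, ← cfc_mul _ _ T hc' hci']
  refine norm_cfc_le hε.le fun t ht => ?_
  have ht0 := h0 t ht
  have ht1 : 0 < t + ε := by positivity
  rw [Real.norm_of_nonneg (by positivity)]
  -- The bound reduces to `ε t ≤ (t + ε)²`.
  have : ε * (t + ε)⁻¹ * (t * (ε * (t + ε)⁻¹)) = ε ^ 2 * t / (t + ε) ^ 2 := by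
    field_simp
  rw [this, div_le_iff₀ (by positivity)]
  nlinarith [mul_nonneg hε.le (sq_nonneg t), mul_nonneg hε.le (sq_nonneg ε),
    mul_nonneg (mul_nonneg hε.le hε.le) ht0]

end CStarAlgebra

/-! ### Complemented ranges, positivity and polar decomposition on Hilbert modules. -/

variable {𝔄 E F G : Type*} [NonUnitalCStarAlgebra 𝔄] [PartialOrder 𝔄] [StarOrderedRing 𝔄]
variable [NormedAddCommGroup E] [NormedSpace ℂ E] [SMul 𝔄 E] [CStarModule 𝔄 E]
variable [NormedAddCommGroup F] [NormedSpace ℂ F] [SMul 𝔄 F] [CStarModule 𝔄 F]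
variable [NormedAddCommGroup G] [NormedSpace ℂ G] [SMul 𝔄 G] [CStarModule 𝔄 G]

namespace Adjointable

theorem inner_comm_zero {x y : E} (h : inner 𝔄 x y = 0) : inner 𝔄 y x = 0 := by
  rw [← CStarModule.star_inner, h, star_zero]

theorem continuous_inner_right (x : E) : Continuous fun y : E => inner 𝔄 x y :=
  (CStarModule.innerSL (A := 𝔄) x).continuous

/-- The kernel of the adjoint is orthogonal to the closure of the range. -/
theorem inner_eq_zero_of_mem_closure {C : Adjointable 𝔄 E F} {z w : F} (hz : C† z = 0)
    (hw : w ∈ closure (Set.range C)) : inner 𝔄 z w = 0 := by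
  have hcl : IsClosed {w : F | inner 𝔄 z w = 0} :=
    isClosed_eq (continuous_inner_right z) continuous_const
  refine closure_minimal (s := Set.range C) ?_ hcl hw
  rintro _ ⟨x, rfl⟩
  change inner 𝔄 z (C x) = 0
  rw [inner_right, hz, CStarModule.inner_zero_left]

theorem norm_eq_of_inner_eq {x : E} {y : F} (h : inner 𝔄 x x = inner 𝔄 y y) : ‖x‖ = ‖y‖ := by
  have h1 : ‖x‖ ^ 2 = ‖y‖ ^ 2 := by
    rw [CStarModule.norm_sq_eq 𝔄, CStarModule.norm_sq_eq 𝔄, h]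
  exact (sq_eq_sq₀ (norm_nonneg _) (norm_nonneg _)).1 h1

theorem adjoint_comp_apply_eq_zero_iff {C : Adjointable 𝔄 E F} {x : E} :
    C† (C x) = 0 ↔ C x = 0 := by
  refine ⟨fun h => ?_, fun h => by rw [h, map_zero]⟩
  rw [← CStarModule.inner_self (A := 𝔄), inner_left, h, CStarModule.inner_zero_right]

/-- The condition `F = closure (range C) + ker C†`. -/
def RangeComplemented (C : Adjointable 𝔄 E F) : Prop :=
  ∀ y : F, ∃ m ∈ closure (Set.range C), ∃ z, C† z = 0 ∧ y = m + z

theorem RangeComplemented.eq_of_mem {C : Adjointable 𝔄 E F} {y m z : F}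
    (hm : m ∈ closure (Set.range C)) (hz : C† z = 0) (h : y = m + z)
    (hy : y ∈ closure (Set.range C)) : m = y := by
  have h1 : inner 𝔄 z z = 0 := by
    have h2 := inner_eq_zero_of_mem_closure hz hy
    rwa [h, CStarModule.inner_add_right, inner_eq_zero_of_mem_closure hz hm, zero_add] at h2
  rw [h, CStarModule.inner_self.1 h1, add_zero]

/-- A vector `z` orthogonal to the range is in particular orthogonal to `C (C† z)`, so `⟨C† z, C† z⟩
= 0`. -/
theorem RangeComplemented.of_rangeClosure [CompleteSpace E] [CompleteSpace F]
    {C : Adjointable 𝔄 E F} (h : C.rangeClosure.IsOrthComplemented) : C.RangeComplemented := by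
  intro y
  obtain ⟨m, hm, z, hz, rfl⟩ := h y
  refine ⟨m, hm, z, ?_, rfl⟩
  rw [← CStarModule.inner_self (A := 𝔄), inner_left]
  exact hz _ (subset_closure ⟨_, rfl⟩)

theorem RangeComplemented.neg {C : Adjointable 𝔄 E F} (h : (-C).RangeComplemented) :
    C.RangeComplemented := by
  have hr : Set.range (-C) = Set.range C := by
    ext y
    constructor
    · rintro ⟨x, rfl⟩; exact ⟨-x, by rw [map_neg]; rfl⟩
    · rintro ⟨x, rfl⟩; exact ⟨-x, by rw [map_neg]; exact neg_neg _⟩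
  intro y
  obtain ⟨m, hm, z, hz, rfl⟩ := h y
  exact ⟨m, hr ▸ hm, z, neg_eq_zero.1 hz, rfl⟩

section Complete

variable [CompleteSpace E] [CompleteSpace F]

/-- `RangeComplemented` passes to compressions along isometries. -/
theorem RangeComplemented.of_comp_comp {E' F' : Type*}
    [NormedAddCommGroup E'] [NormedSpace ℂ E'] [SMul 𝔄 E'] [CStarModule 𝔄 E']
    [NormedAddCommGroup F'] [NormedSpace ℂ F'] [SMul 𝔄 F'] [CStarModule 𝔄 F'] [CompleteSpace F']
    {J : Adjointable 𝔄 F' F} {K : Adjointable 𝔄 E' E} {D : Adjointable 𝔄 E' F'}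
    (hJ : J† ⊚ J = 1) (hK : K† ⊚ K = 1) (h : (J ⊚ D ⊚ K†).RangeComplemented) :
    D.RangeComplemented := by
  have hJ' : ∀ y, J† (J y) = y := DFunLike.congr_fun hJ
  have hK' : ∀ y, K† (K y) = y := DFunLike.congr_fun hK
  intro y
  obtain ⟨m, hm, z, hz, hy⟩ := h (J y)
  refine ⟨J† m, ?_, J† z, ?_, ?_⟩
  · refine map_mem_closure J†.continuous hm ?_
    rintro _ ⟨x, rfl⟩
    exact ⟨K† x, (hJ' _).symm⟩
  · rw [← hK' (D† _)]
    exact (congrArg K† hz).trans (map_zero K†)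
  · rw [← map_add, ← hy, hJ']

/-- A self-adjoint operator `T` with `⟨x, T x⟩ ≥ 0` for all `x` is positive. -/
theorem nonneg_of_inner_nonneg {T : Adjointable 𝔄 E E} (hT : IsSelfAdjoint T)
    (h : ∀ x, 0 ≤ inner 𝔄 x (T x)) : 0 ≤ T := by
  set n := T⁻ with hn
  have hn0 : 0 ≤ n := CFC.negPart_nonneg T
  have hns : IsSelfAdjoint n := .of_nonneg hn0
  set k := CFC.sqrt n with hk
  have hks : IsSelfAdjoint k := .of_nonneg (CFC.sqrt_nonneg n)
  have hkk : k * k = n := CFC.sqrt_mul_sqrt_self n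
  -- Compressing `T` by its negative part `n` gives `-n³`, which is minus a square. Testing the
  -- hypothesis on vectors `n x` then forces `k n = 0`.
  have hTn : n * T * n = -(star (k * n) * (k * n)) := by
    have h1 : T * n = -(n * n) := by
      conv_lhs => rw [← CFC.posPart_sub_negPart T hT]
      rw [sub_mul, CFC.posPart_mul_negPart, zero_sub]
    rw [mul_assoc, h1, star_mul, hks.star_eq, hns.star_eq, mul_neg, mul_assoc n k, ← mul_assoc k k,
      hkk]
  have hkn : k * n = 0 := by
    ext x
    have h1 := h (n x)
    have h2 : inner 𝔄 (n x) (T (n x)) = -inner 𝔄 ((k * n) x) ((k * n) x) := by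
      rw [inner_left, show n† = n from hns, inner_left]
      have := congrArg (fun S : Adjointable 𝔄 E E => inner 𝔄 x (S x)) hTn
      rw [Adjointable.neg_apply, CStarModule.inner_neg_right] at this
      exact this
    rw [h2, Left.nonneg_neg_iff] at h1
    exact CStarModule.inner_self.1 (le_antisymm h1 CStarModule.inner_self_nonneg)
  have hnn : n = 0 := by
    rw [← CStarRing.star_mul_self_eq_zero_iff, hns.star_eq]
    nth_rewrite 1 [← hkk]
    rw [mul_assoc, hkn, mul_zero]
  have := CFC.posPart_sub_negPart T hT
  rw [← hn, hnn, sub_zero] at this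
  rw [← this]
  exact CFC.posPart_nonneg T

theorem adjoint_comp_self_nonneg (C : Adjointable 𝔄 E F) : 0 ≤ C† ⊚ C :=
  nonneg_of_inner_nonneg rfl fun x => by
    have : inner 𝔄 x ((C† ⊚ C) x) = inner 𝔄 (C x) (C x) := (C.inner_left x (C x)).symm
    rw [this]
    exact CStarModule.inner_self_nonneg

/-- The ranges of `C†` and `C† C` have the same closure. -/
theorem closure_range_adjoint (C : Adjointable 𝔄 E F) :
    closure (Set.range C†) = closure (Set.range (C† ⊚ C)) := by
  refine (closure_minimal ?_ isClosed_closure).antisymm (closure_mono ?_)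
  swap
  · rintro _ ⟨x, rfl⟩; exact ⟨C x, rfl⟩
  rintro _ ⟨x, rfl⟩
  rw [Metric.mem_closure_iff]
  intro ε hε
  obtain ⟨δ, hδ, hδε⟩ : ∃ δ > 0, δ * ‖x‖ ^ 2 < ε ^ 2 := by
    refine ⟨ε ^ 2 / (‖x‖ ^ 2 + 1), by positivity, ?_⟩
    rw [div_mul_eq_mul_div, div_lt_iff₀ (by positivity)]
    nlinarith [sq_nonneg ‖x‖, pow_pos hε 2]
  have hCC : 0 ≤ C ⊚ C† := adjoint_comp_self_nonneg C†
  obtain ⟨r, hr, hn⟩ := exists_approx_inverse hCC hδ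
  set e := 1 - (C ⊚ C†) * r with he
  -- As `r` approximates an inverse of `C C†`, the error is `C† (e x)`, with squared norm `‖⟨x, e C
  -- C† e x⟩‖ ≤ δ ‖x‖²`.
  refine ⟨(C† ⊚ C) (C† (r x)), ⟨_, rfl⟩, ?_⟩
  have h1 : C† x - (C† ⊚ C) (C† (r x)) = C† (e x) := by
    rw [he, Adjointable.sub_apply, map_sub]; rfl
  rw [dist_eq_norm, h1]
  refine lt_of_pow_lt_pow_left₀ 2 hε.le (lt_of_le_of_lt ?_ hδε)
  have h2 : inner 𝔄 (C† (e x)) (C† (e x)) = inner 𝔄 x ((e * ((C ⊚ C†) * e)) x) := by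
    rw [inner_left, inner_left, show e† = e from hr]; rfl
  rw [CStarModule.norm_sq_eq 𝔄, h2]
  calc _ ≤ ‖x‖ * ‖(e * ((C ⊚ C†) * e)) x‖ := CStarModule.norm_inner_le F
    _ ≤ ‖x‖ * (δ * ‖x‖) := by
      gcongr
      exact (norm_apply_le _ _).trans (by gcongr)
    _ = _ := by ring

/-- Equal distances make `g` Cauchy along any sequence on which `f` converges; completeness of `F`
provides the second coordinate. -/
theorem exists_mem_closure_graph {X : Type*} {f : X → E} {g : X → F}
    (hfg : ∀ a b, dist (g a) (g b) = dist (f a) (f b)) {m : E} (hm : m ∈ closure (Set.range f)) :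
    ∃ w, (m, w) ∈ closure (Set.range fun t => (f t, g t)) := by
  obtain ⟨u, hu, hlim⟩ := mem_closure_iff_seq_limit.1 hm
  choose t ht using hu
  obtain rfl : (fun n => f (t n)) = u := funext ht
  have hc : CauchySeq fun n => g (t n) := by
    have := hlim.cauchySeq
    rw [Metric.cauchySeq_iff] at this ⊢
    simpa only [hfg] using this
  obtain ⟨w, hw⟩ := cauchySeq_tendsto_of_complete hc
  exact ⟨w, mem_closure_iff_seq_limit.2 ⟨_, fun n => ⟨t n, rfl⟩, hlim.prodMk_nhds hw⟩⟩

/-- The polar decomposition `C = U L`, `L = (C† C)^{1/2}`, of an operator such that the closures of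
the ranges of `C` and `L` are orthogonally complemented. -/
theorem exists_polar_decomposition {L : Adjointable 𝔄 E E} {C : Adjointable 𝔄 E F}
    (hL : IsSelfAdjoint L) (hLC : L * L = C† ⊚ C) (hl : L.RangeComplemented)
    (hr : C.RangeComplemented) :
    ∃ U : Adjointable 𝔄 E F, U ⊚ L = C ∧ IsPartialIsometry U ∧
      Set.range U† = closure (Set.range L) ∧ ∀ z, L z = 0 → U z = 0 := by
  have hL' : L† = L := hL
  have hin : ∀ a b, inner 𝔄 (L a) (L b) = inner 𝔄 (C a) (C b) := fun a b => by
    rw [inner_left, inner_left, hL']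
    exact congrArg (fun S : Adjointable 𝔄 E E => inner 𝔄 a (S b)) hLC
  have hd : ∀ a b, dist (C a) (C b) = dist (L a) (L b) := fun a b => by
    rw [dist_eq_norm, dist_eq_norm, ← map_sub, ← map_sub]
    exact (norm_eq_of_inner_eq (hin _ _)).symm
  -- `Γ` is the closed graph of the isometry `L t ↦ C t`. Read forwards it yields `U`, read
  -- backwards `U†`.
  set Γ : Set (E × F) := closure (Set.range fun t => (L t, C t)) with hΓ
  have hcl : ∀ (x : E) (y : F), IsClosed {p : E × F | inner 𝔄 x p.1 = inner 𝔄 y p.2} := fun x y =>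
    isClosed_eq ((continuous_inner_right x).comp continuous_fst)
      ((continuous_inner_right y).comp continuous_snd)
  have hΓ1 : ∀ a, ∀ p ∈ Γ, inner 𝔄 (L a) p.1 = inner 𝔄 (C a) p.2 := fun a p hp => by
    refine closure_minimal ?_ (hcl (L a) (C a)) hp
    rintro _ ⟨b, rfl⟩
    exact hin a b
  have hΓ2 : ∀ p ∈ Γ, ∀ q ∈ Γ, inner 𝔄 p.1 q.1 = inner 𝔄 p.2 q.2 := fun p hp q hq => by
    refine closure_minimal ?_ (hcl p.1 p.2) hq
    rintro _ ⟨b, rfl⟩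
    change inner 𝔄 p.1 (L b) = inner 𝔄 p.2 (C b)
    rw [← CStarModule.star_inner, hΓ1 b p hp, CStarModule.star_inner]
  have hΓl : ∀ p ∈ Γ, p.1 ∈ closure (Set.range L) := fun p hp =>
    map_mem_closure continuous_fst hp (by rintro _ ⟨b, rfl⟩; exact ⟨b, rfl⟩)
  have hΓr : ∀ p ∈ Γ, p.2 ∈ closure (Set.range C) := fun p hp =>
    map_mem_closure continuous_snd hp (by rintro _ ⟨b, rfl⟩; exact ⟨b, rfl⟩)
  have huniq : ∀ m w w', (m, w) ∈ Γ → (m, w') ∈ Γ → w = w' := fun m w w' h h' => by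
    rw [← sub_eq_zero, ← CStarModule.inner_self (A := 𝔄)]
    simp only [CStarModule.inner_sub_left, CStarModule.inner_sub_right,
      ← hΓ2 _ h _ h, ← hΓ2 _ h _ h', ← hΓ2 _ h' _ h, ← hΓ2 _ h' _ h', sub_self]
  have huniq' : ∀ m m' w, (m, w) ∈ Γ → (m', w) ∈ Γ → m = m' := fun m m' w h h' => by
    rw [← sub_eq_zero, ← CStarModule.inner_self (A := 𝔄)]
    simp only [CStarModule.inner_sub_left, CStarModule.inner_sub_right,
      hΓ2 _ h _ h, hΓ2 _ h _ h', hΓ2 _ h' _ h, hΓ2 _ h' _ h', sub_self]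
  choose m hm z hz hx using hl
  choose m' hm' z' hz' hy using hr
  choose w hw using fun x => exists_mem_closure_graph (f := L) (g := C) hd (hm x)
  have hex : ∀ y, ∃ v, (v, m' y) ∈ Γ := fun y => by
    obtain ⟨v, hv⟩ := exists_mem_closure_graph (f := C) (g := L) (fun a b => (hd a b).symm) (hm' y)
    refine ⟨v, map_mem_closure (f := Prod.swap) continuous_swap hv ?_⟩
    rintro _ ⟨b, rfl⟩
    exact ⟨b, rfl⟩
  choose v hv using hex
  -- Both maps first project onto the closed range (`m`, `m'`) and then follow `Γ`. The
  -- complementary parts drop out of the inner products, and the adjoint relation is the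
  -- preservation of inner products along `Γ`.
  let U : Adjointable 𝔄 E F := ⟨w, v, fun x y => by
    have h1 : inner 𝔄 (w x) y = inner 𝔄 (w x) (m' y) := by
      conv_lhs => rw [hy y]
      rw [CStarModule.inner_add_right,
        inner_comm_zero (inner_eq_zero_of_mem_closure (hz' y) (hΓr _ (hw x))), add_zero]
    have h2 : inner 𝔄 x (v y) = inner 𝔄 (m x) (v y) := by
      conv_lhs => rw [hx x]
      rw [CStarModule.inner_add_left, inner_eq_zero_of_mem_closure (hz x) (hΓl _ (hv y)), add_zero]
    rw [h1, h2]
    exact (hΓ2 _ (hw x) _ (hv y)).symm⟩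
  have hmx : ∀ x ∈ closure (Set.range L), m x = x := fun x h =>
    RangeComplemented.eq_of_mem (hm x) (hz x) (hx x) h
  have hmy : ∀ y ∈ closure (Set.range C), m' y = y := fun y h =>
    RangeComplemented.eq_of_mem (hm' y) (hz' y) (hy y) h
  have hU0 : ∀ x, L x = 0 → U x = 0 := fun x h0 => by
    have h1 : m x = 0 := by
      have h2 : inner 𝔄 (m x) (m x) = 0 := by
        have h3 : L† (m x) = 0 := by
          have := congrArg L† (hx x)
          rw [map_add, hz x, add_zero] at this
          rw [← this, hL', h0]
        exact inner_eq_zero_of_mem_closure h3 (hm x)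
      exact CStarModule.inner_self.1 h2
    have h4 := hΓ2 _ (hw x) _ (hw x)
    simp only [h1, CStarModule.inner_zero_left] at h4
    exact CStarModule.inner_self.1 h4.symm
  -- `Γ` is also single-valued backwards, so `U† U` is the projection onto the closed range of `L`.
  have hUU : ∀ x, U† (U x) = m x := fun x => by
    have h1 := hv (w x)
    rw [hmy _ (hΓr _ (hw x))] at h1
    exact huniq' _ _ _ h1 (hw x)
  refine ⟨U, ?_, ?_, ?_, hU0⟩
  · ext t
    have h1 := hw (L t)
    rw [hmx _ (subset_closure ⟨t, rfl⟩)] at h1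
    exact huniq _ _ _ h1 (subset_closure ⟨t, rfl⟩)
  · ext x
    change U (U† (U x)) = U x
    rw [hUU]
    conv_rhs => rw [hx x]
    rw [map_add, hU0 (z x) (hL' ▸ hz x), add_zero]
  · refine Set.Subset.antisymm ?_ fun x h => ⟨U x, (hUU x).trans (hmx x h)⟩
    rintro _ ⟨y, rfl⟩
    exact hΓl _ (hv y)

end Complete

end Adjointable

open Adjointable
open scoped WithCStarModule

/-! ### Algebra of composition and adjoints. -/

namespace Adjointable

variable {G' : Type*} [NormedAddCommGroup G'] [NormedSpace ℂ G'] [SMul 𝔄 G'] [CStarModule 𝔄 G']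

theorem comp_assoc (S : Adjointable 𝔄 F G) (T : Adjointable 𝔄 E F) (R : Adjointable 𝔄 G' E) :
    (S ⊚ T) ⊚ R = S ⊚ T ⊚ R := rfl

theorem mul_eq_comp (S T : Adjointable 𝔄 E E) : S * T = S ⊚ T := rfl

theorem adjoint_comp (S : Adjointable 𝔄 F G) (T : Adjointable 𝔄 E F) :
    (S ⊚ T)† = T† ⊚ S† := rfl

theorem one_comp (T : Adjointable 𝔄 E F) : (1 : Adjointable 𝔄 F F) ⊚ T = T := rfl

theorem comp_one (T : Adjointable 𝔄 E F) : T ⊚ (1 : Adjointable 𝔄 E E) = T := rfl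

theorem zero_comp (T : Adjointable 𝔄 E F) : (0 : Adjointable 𝔄 F G) ⊚ T = 0 := by
  ext x; rfl

theorem comp_zero (T : Adjointable 𝔄 F G) : T ⊚ (0 : Adjointable 𝔄 E F) = 0 := by
  ext x; exact map_zero T

theorem add_comp (S T : Adjointable 𝔄 F G) (R : Adjointable 𝔄 E F) :
    (S + T) ⊚ R = S ⊚ R + T ⊚ R := by
  ext x; rfl

theorem sub_comp (S T : Adjointable 𝔄 F G) (R : Adjointable 𝔄 E F) :
    (S - T) ⊚ R = S ⊚ R - T ⊚ R := by
  ext x; rfl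

theorem neg_comp (S : Adjointable 𝔄 F G) (R : Adjointable 𝔄 E F) : (-S) ⊚ R = -(S ⊚ R) := by
  ext x; rfl

theorem comp_add (R : Adjointable 𝔄 F G) (S T : Adjointable 𝔄 E F) :
    R ⊚ (S + T) = R ⊚ S + R ⊚ T := by
  ext x; exact map_add R _ _

theorem comp_sub (R : Adjointable 𝔄 F G) (S T : Adjointable 𝔄 E F) :
    R ⊚ (S - T) = R ⊚ S - R ⊚ T := by
  ext x; exact map_sub R _ _

theorem comp_neg (R : Adjointable 𝔄 F G) (S : Adjointable 𝔄 E F) : R ⊚ (-S) = -(R ⊚ S) := by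
  ext x; exact map_neg R _

theorem adjoint_add (S T : Adjointable 𝔄 E F) : (S + T)† = S† + T† := rfl

theorem adjoint_sub (S T : Adjointable 𝔄 E F) : (S - T)† = S† - T† := rfl

theorem adjoint_neg (S : Adjointable 𝔄 E F) : (-S)† = -S† := rfl

theorem adjoint_one : (1 : Adjointable 𝔄 E E)† = 1 := rfl

theorem adjoint_zero : (0 : Adjointable 𝔄 E F)† = 0 := rfl

end Adjointable

/-! ### Operator matrices and the splitting by a projection. -/

section Blocks

variable [CompleteSpace E] [CompleteSpace F]

theorem block_comp (a a' : Adjointable 𝔄 E E) (b b' : Adjointable 𝔄 F E) (c c' : Adjointable 𝔄 E F)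
    (d d' : Adjointable 𝔄 F F) :
    block a b c d ⊚ block a' b' c' d' =
      block (a ⊚ a' + b ⊚ c') (a ⊚ b' + b ⊚ d') (c ⊚ a' + d ⊚ c') (c ⊚ b' + d ⊚ d') := by
  ext x
  change (WithCStarModule.equiv 𝔄 (E × F)).symm
      (a (a' x.1 + b' x.2) + b (c' x.1 + d' x.2), c (a' x.1 + b' x.2) + d (c' x.1 + d' x.2)) =
    (WithCStarModule.equiv 𝔄 (E × F)).symm
      ((a (a' x.1) + b (c' x.1)) + (a (b' x.2) + b (d' x.2)),
        (c (a' x.1) + d (c' x.1)) + (c (b' x.2) + d (d' x.2)))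
  congr 2
  · rw [map_add, map_add]; abel
  · rw [map_add, map_add]; abel

theorem block_sub (a a' : Adjointable 𝔄 E E) (b b' : Adjointable 𝔄 F E) (c c' : Adjointable 𝔄 E F)
    (d d' : Adjointable 𝔄 F F) :
    block a b c d - block a' b' c' d' = block (a - a') (b - b') (c - c') (d - d') := by
  ext x
  change (WithCStarModule.equiv 𝔄 (E × F)).symm (a x.1 + b x.2, c x.1 + d x.2) -
      (WithCStarModule.equiv 𝔄 (E × F)).symm (a' x.1 + b' x.2, c' x.1 + d' x.2) =
    (WithCStarModule.equiv 𝔄 (E × F)).symm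
      ((a x.1 - a' x.1) + (b x.2 - b' x.2), (c x.1 - c' x.1) + (d x.2 - d' x.2))
  exact congrArg (WithCStarModule.equiv 𝔄 (E × F)).symm
    (Prod.ext (add_sub_add_comm _ _ _ _) (add_sub_add_comm _ _ _ _))

theorem block_one : block (1 : Adjointable 𝔄 E E) 0 0 (1 : Adjointable 𝔄 F F) = 1 := by
  ext x
  change (WithCStarModule.equiv 𝔄 (E × F)).symm (x.1 + 0, 0 + x.2) = x
  rw [add_zero, zero_add]
  rfl

theorem adjoint_block (a : Adjointable 𝔄 E E) (b : Adjointable 𝔄 F E) (c : Adjointable 𝔄 E F)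
    (d : Adjointable 𝔄 F F) : (block a b c d)† = block a† c† b† d† := rfl

theorem block_injective {a a' : Adjointable 𝔄 E E} {b b' : Adjointable 𝔄 F E}
    {c c' : Adjointable 𝔄 E F} {d d' : Adjointable 𝔄 F F}
    (h : block a b c d = block a' b' c' d') : a = a' ∧ b = b' ∧ c = c' ∧ d = d' := by
  have key : ∀ (x : E) (y : F), (a x + b y, c x + d y) = (a' x + b' y, c' x + d' y) := fun x y =>
    congrArg (fun S => WithCStarModule.equiv 𝔄 (E × F)
      (S ((WithCStarModule.equiv 𝔄 (E × F)).symm (x, y)))) h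
  simp only [Prod.mk.injEq] at key
  refine ⟨?_, ?_, ?_, ?_⟩
  · ext x; simpa using (key x 0).1
  · ext x; simpa using (key 0 x).1
  · ext x; simpa using (key x 0).2
  · ext x; simpa using (key 0 x).2

/-- The inclusion of the range of a projection. -/
def rangeIncl (P : Adjointable 𝔄 E E) (hP : IsStarProjection P) : Adjointable 𝔄 (range P hP) E where
  toFun x := x.val
  adjFun x := .mk (P x) (mem_range_self P hP x)
  inner_adj' x y := by
    have hs : P† = P := hP.isSelfAdjoint
    have hz : P x.val = x.val := by
      obtain ⟨z, hz⟩ := mem_range.1 x.mem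
      rw [← hz, ← Adjointable.mul_apply, hP.isIdempotentElem.eq]
    rw [ClosedSub.inner_coe, ClosedSub.Elem.val_mk, inner_right, hs, hz]

/-- The inclusion of the kernel of a projection. -/
def kerIncl (P : Adjointable 𝔄 E E) (hP : IsStarProjection P) : Adjointable 𝔄 (ker P) E where
  toFun x := x.val
  adjFun x := .mk ((1 - P) x) (compl_mem_ker P hP x)
  inner_adj' x y := by
    have hs : P† = P := hP.isSelfAdjoint
    have hz : P x.val = 0 := mem_ker.1 x.mem
    rw [ClosedSub.inner_coe, ClosedSub.Elem.val_mk, Adjointable.sub_apply,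
      CStarModule.inner_sub_right, inner_right P, hs, hz, CStarModule.inner_zero_left, sub_zero,
      Adjointable.one_apply]

variable (P : Adjointable 𝔄 E E) (hP : IsStarProjection P)

theorem adjoint_comp_rangeIncl : (rangeIncl P hP)† ⊚ rangeIncl P hP = 1 := by
  ext x
  change P x.val = x.val
  obtain ⟨z, hz⟩ := mem_range.1 x.mem
  rw [← hz, ← Adjointable.mul_apply, hP.isIdempotentElem.eq]

theorem adjoint_comp_kerIncl : (kerIncl P hP)† ⊚ kerIncl P hP = 1 := by
  ext x
  change x.val - P x.val = x.val
  rw [mem_ker.1 x.mem, sub_zero]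

theorem splitting_comp_adjoint : splitting P hP ⊚ (splitting P hP)† = 1 := by
  ext x
  have h1 : P x.1.val = x.1.val := by
    obtain ⟨z, hz⟩ := mem_range.1 x.1.mem
    rw [← hz, ← Adjointable.mul_apply, hP.isIdempotentElem.eq]
  have h2 : P x.2.val = 0 := mem_ker.1 x.2.mem
  change (WithCStarModule.equiv 𝔄 (range P hP × ker P)).symm
    (.mk (P (x.1.val + x.2.val)) _, .mk ((x.1.val + x.2.val) - P (x.1.val + x.2.val)) _) =
    (WithCStarModule.equiv 𝔄 (range P hP × ker P)).symm (x.1, x.2)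
  congr 2
  · ext; simp [h1, h2]
  · ext; simp [h1, h2]

theorem adjoint_comp_splitting : (splitting P hP)† ⊚ splitting P hP = 1 := by
  ext x
  change P x + (x - P x) = x
  abel

theorem splitting_comp_comp_adjoint (Q : Adjointable 𝔄 E E) :
    splitting P hP ⊚ Q ⊚ (splitting P hP)† =
      block ((rangeIncl P hP)† ⊚ Q ⊚ rangeIncl P hP) ((rangeIncl P hP)† ⊚ Q ⊚ kerIncl P hP)
        ((kerIncl P hP)† ⊚ Q ⊚ rangeIncl P hP) ((kerIncl P hP)† ⊚ Q ⊚ kerIncl P hP) := by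
  ext x
  change (WithCStarModule.equiv 𝔄 (range P hP × ker P)).symm
    ((rangeIncl P hP)† (Q (rangeIncl P hP x.1 + kerIncl P hP x.2)),
      (kerIncl P hP)† (Q (rangeIncl P hP x.1 + kerIncl P hP x.2))) = _
  rw [map_add, map_add, map_add]
  rfl

end Blocks

/-! ### Existence of a canonical representation. -/

section Existence

variable [CompleteSpace E] [CompleteSpace F]

theorem isSelfAdjoint_ell (A : Adjointable 𝔄 E E) : IsSelfAdjoint (ell A) :=
  .of_nonneg (CFC.sqrt_nonneg _)

theorem ell_mul_ell {A : Adjointable 𝔄 E E} (h : 0 ≤ A ^ 2 - A) : ell A * ell A = A ^ 2 - A :=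
  CFC.sqrt_mul_sqrt_self _ h

/-- The entries of an idempotent operator matrix `(A, -C†; C, D)` with `A`, `D` self-adjoint. -/
theorem exists_canonical_entries {A : Adjointable 𝔄 E E} {C : Adjointable 𝔄 E F}
    {D : Adjointable 𝔄 F F} (hA : IsSelfAdjoint A) (hD : IsSelfAdjoint D)
    (h : block A (-C†) C D ⊚ block A (-C†) C D = block A (-C†) C D)
    (hC : C.RangeComplemented) (hC' : (C†).RangeComplemented) :
    0 ≤ A ^ 2 - A ∧ ∃ (U : Adjointable 𝔄 E F) (Q₀ : Adjointable 𝔄 F F),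
      IsPartialIsometry U ∧ IsStarProjection Q₀ ∧
      Set.range U† = closure (Set.range ⇑(A ^ 2 - A)) ∧ U† ⊚ Q₀ = 0 ∧
      C = U ⊚ ell A ∧ D = U ⊚ (1 - A) ⊚ U† + Q₀ := by
  rw [block_comp] at h
  obtain ⟨h1, -, h3, h4⟩ := block_injective h
  have hAC : A ^ 2 - A = C† ⊚ C := by
    rw [neg_comp, ← sub_eq_add_neg, sub_eq_iff_eq_add] at h1
    rw [pow_two, mul_eq_comp, h1, add_sub_cancel_left]
  have hpos : 0 ≤ A ^ 2 - A := hAC ▸ adjoint_comp_self_nonneg C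
  have hLs := isSelfAdjoint_ell A
  have hL' : (ell A)† = ell A := hLs
  have hLL := ell_mul_ell hpos
  have hcl : closure (Set.range (ell A)) = closure (Set.range ⇑(A ^ 2 - A)) := by
    have := closure_range_adjoint (ell A)
    rwa [hL', ← mul_eq_comp, hLL] at this
  -- Since `ℓ(A)² = C† C`, the operators `ℓ(A)` and `C` have the same kernel, and the ranges of
  -- `ℓ(A)` and `C†` have the same closure. The decomposition for `C†` therefore serves for `ℓ(A)`.
  have hLr : (ell A).RangeComplemented := by
    intro y
    obtain ⟨m, hm, z, hz, hy⟩ := hC' y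
    refine ⟨m, ?_, z, ?_, hy⟩
    · rwa [hcl, hAC, ← closure_range_adjoint]
    · rw [hL', ← adjoint_comp_apply_eq_zero_iff, hL']
      change (ell A * ell A) z = 0
      rw [hLL, hAC]
      exact adjoint_comp_apply_eq_zero_iff.2 hz
  obtain ⟨U, hUL, hU, hUr, hU0⟩ := exists_polar_decomposition hLs (hLL.trans hAC) hLr hC
  have hUL' : ∀ t, U (ell A t) = C t := DFunLike.congr_fun hUL
  have hAL : ∀ x, A (ell A x) = ell A (A x) :=
    DFunLike.congr_fun ((gapCalculus hA hpos).of_commute A (Commute.refl A)).2.2.symm.eq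
  have h3' : ∀ t, C (A t) + D (C t) = C t := DFunLike.congr_fun h3
  -- The lower left entry of idempotency, `C A + D C = C`, gives this on the range of `ℓ(A)` because
  -- `C = U ℓ(A)`; continuity extends it to the closure. On the kernel of `ℓ(A)`, which `A`
  -- preserves, both sides vanish.
  have hDU : D ⊚ U = U ⊚ (1 - A) := by
    have hclosed : IsClosed {x | D (U x) = U ((1 - A) x)} :=
      isClosed_eq (D.continuous.comp U.continuous) (U.continuous.comp (1 - A).continuous)
    have hm : ∀ m ∈ closure (Set.range (ell A)), D (U m) = U ((1 - A) m) := by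
      refine fun m hm => closure_minimal ?_ hclosed hm
      rintro _ ⟨t, rfl⟩
      change D (U (ell A t)) = U (ell A t - A (ell A t))
      rw [hAL, map_sub, hUL', hUL', eq_sub_iff_add_eq', h3']
    ext x
    obtain ⟨m, hm', z, hz, rfl⟩ := hLr x
    rw [hL'] at hz
    change D (U (m + z)) = U ((1 - A) (m + z))
    have h5 : U ((1 - A) z) = 0 := hU0 _ <| by
      change ell A (z - A z) = 0
      rw [map_sub, ← hAL, hz, map_zero, sub_zero]
    rw [map_add, map_add, map_add, map_add, hU0 z hz, h5, hm m hm', map_zero]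
  have hUD : U† ⊚ D = (1 - A) ⊚ U† := by
    have := congrArg Adjointable.adjoint hDU
    rwa [adjoint_comp, adjoint_comp, show D† = D from hD, adjoint_sub, adjoint_one,
      show A† = A from hA] at this
  have hUU : U† ⊚ U ⊚ U† = U† := congrArg Adjointable.adjoint hU
  set Q₀ := D - U ⊚ (1 - A) ⊚ U† with hQ₀
  have hUQ : U† ⊚ Q₀ = 0 := by
    rw [hQ₀, comp_sub, hUD, ← comp_assoc U, ← hDU, comp_assoc, ← comp_assoc U†, hUD, comp_assoc,
      hUU, sub_self]
  have hQs : IsSelfAdjoint Q₀ := by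
    change Q₀† = Q₀
    rw [hQ₀, adjoint_sub, adjoint_comp, adjoint_comp, adjoint_sub, adjoint_one,
      show D† = D from hD, show A† = A from hA, adjoint_adjoint, comp_assoc]
  refine ⟨hpos, U, Q₀, hU, ⟨?_, hQs⟩, hUr.trans hcl, hUQ, hUL.symm, ?_⟩
  -- Idempotency of `Q₀` reduces to `D Q₀ = Q₀`, as `U† Q₀ = 0`. The lower right entry gives `D² = D
  -- + C C†`, and the terms in `C C†` cancel because `C† U U† = C†`.
  · have h5 : Q₀ = D - D ⊚ U ⊚ U† := by rw [hQ₀, ← comp_assoc D, hDU]; rfl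
    have h6 : C† ⊚ U ⊚ U† = C† := by
      rw [← hUL, adjoint_comp, comp_assoc, hUU]
    have h7 : D ⊚ D = D + C ⊚ C† := by
      rw [comp_neg] at h4
      rw [← eq_sub_iff_add_eq'] at h4
      rw [h4]; abel
    have h8 : D ⊚ Q₀ = Q₀ := by
      rw [h5, comp_sub, ← comp_assoc D D, h7, add_comp, comp_assoc C, h6]
      abel
    have h9 : (D - U ⊚ (1 - A) ⊚ U†) ⊚ Q₀ = D ⊚ Q₀ := by
      rw [sub_comp, comp_assoc, comp_assoc, hUQ, comp_zero, comp_zero, sub_zero]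
    exact h9.trans h8
  · rw [hQ₀]; abel

/-- Compressed to the corners, the three pair identities say that the diagonal entries of `Q` are
self-adjoint and the upper right one is `-C†`. Complementedness of the ranges passes to the corners
along the inclusions. -/
theorem IsHarmonious.exists_isCanonicalRep {P Q : Adjointable 𝔄 E E} (hP : IsStarProjection P)
    (h : IsHarmonious P Q) : ∃ A U Q₀, IsCanonicalRep P hP Q A U Q₀ := by
  set J := rangeIncl P hP with hJ
  set K := kerIncl P hP with hK
  have hJP : ∀ x, P (J x) = J x := DFunLike.congr_fun
    (show J ⊚ J† ⊚ J = J by rw [adjoint_comp_rangeIncl, comp_one])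
  have hJP' : ∀ x, J† (P x) = J† x := DFunLike.congr_fun
    (show (J† ⊚ J) ⊚ J† = J† by rw [adjoint_comp_rangeIncl, one_comp])
  have hKP : ∀ x, (1 - P) (K x) = K x := DFunLike.congr_fun
    (show K ⊚ K† ⊚ K = K by rw [adjoint_comp_kerIncl, comp_one])
  have hKP' : ∀ x, K† ((1 - P) x) = K† x := DFunLike.congr_fun
    (show (K† ⊚ K) ⊚ K† = K† by rw [adjoint_comp_kerIncl, one_comp])
  set A := J† ⊚ Q ⊚ J with hA
  set C := K† ⊚ Q ⊚ J with hC
  set D := K† ⊚ Q ⊚ K with hD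
  have hAs : IsSelfAdjoint A := by
    change A† = A
    ext1 x
    have h1 := congrArg J† (DFunLike.congr_fun h.eq₁₁ (J x))
    simp only [Adjointable.mul_apply, hJP, hJP', star_eq_adjoint] at h1
    exact h1
  have hDs : IsSelfAdjoint D := by
    change D† = D
    ext1 x
    have h1 := congrArg K† (DFunLike.congr_fun h.eq₂₂ (K x))
    simp only [Adjointable.mul_apply, hKP, hKP', star_eq_adjoint] at h1
    exact h1
  have hCs : J† ⊚ Q ⊚ K = -C† := by
    ext1 x
    have h1 := congrArg J† (DFunLike.congr_fun h.eq₁₂ (K x))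
    simp only [Adjointable.mul_apply, Adjointable.neg_apply, map_neg, hKP, hJP',
      star_eq_adjoint] at h1
    exact (neg_eq_iff_eq_neg.2 h1).symm
  have hblock : splitting P hP ⊚ Q ⊚ (splitting P hP)† = block A (-C†) C D := by
    rw [splitting_comp_comp_adjoint, hCs]
  have hidem : block A (-C†) C D ⊚ block A (-C†) C D = block A (-C†) C D := by
    rw [← hblock]
    conv_lhs => rw [comp_assoc, comp_assoc, ← comp_assoc _ (splitting P hP),
      adjoint_comp_splitting, one_comp, ← comp_assoc Q]
    exact congrArg (fun S => splitting P hP ⊚ S ⊚ (splitting P hP)†) h.isIdempotentElem.eq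
  have hCr : C.RangeComplemented := by
    refine .of_comp_comp (J := K) (K := J) (adjoint_comp_kerIncl P hP)
      (adjoint_comp_rangeIncl P hP) ?_
    exact RangeComplemented.of_rangeClosure h.complemented₆
  have hCr' : (C†).RangeComplemented := by
    refine .neg (hCs ▸ .of_comp_comp (J := J) (K := K) (adjoint_comp_rangeIncl P hP)
      (adjoint_comp_kerIncl P hP) ?_)
    exact RangeComplemented.of_rangeClosure h.complemented₅
  obtain ⟨hpos, U, Q₀, hU, hQ₀, hr, hUQ, hCU, hDU⟩ :=
    exists_canonical_entries hAs hDs hidem hCr hCr'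
  refine ⟨A, U, Q₀, hAs, hpos, hU, hQ₀, hr, hUQ, ?_⟩
  have hCL : C† = ell A ⊚ U† := by
    rw [hCU, adjoint_comp, show (ell A)† = ell A from isSelfAdjoint_ell A]
  rw [hblock, ← hCL, ← hCU, ← hDU]

end Existence

/-! ### The projection onto the null space of `Q`. -/

section Kernel

variable [CompleteSpace E] [CompleteSpace F]

/-- A self-adjoint `N` with `Q N = 0` and `N (1 - Q) = 1 - Q` is the projection onto `𝓝(Q)`. -/
theorem exists_isOrthComplemented_ker {Q N : Adjointable 𝔄 E E} (hN : IsSelfAdjoint N)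
    (h1 : Q * N = 0) (h2 : N * (1 - Q) = 1 - Q) :
    (ker Q).IsOrthComplemented ∧ ∀ h, (ker Q).proj h = N := by
  have hQN : ∀ x, Q (N x) = 0 := DFunLike.congr_fun h1
  have hfix : ∀ y, Q y = 0 → N y = y := fun y hy => by
    have := DFunLike.congr_fun h2 y
    simpa [hy] using this
  have horth : ∀ x, x - N x ∈ (ker Q).orth := fun x y hy => by
    rw [CStarModule.inner_sub_left, inner_left, show N† = N from hN, hfix y hy, sub_self]
  refine ⟨fun x => ⟨N x, hQN x, x - N x, horth x, by abel⟩, fun h => ?_⟩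
  ext x
  obtain ⟨h3, h4⟩ := (ker Q).proj_spec h x
  have h5 : Q ((ker Q).proj h x - N x) = 0 := by
    rw [map_sub, hQN, show Q ((ker Q).proj h x) = 0 from h3, sub_self]
  rw [← sub_eq_zero, ← CStarModule.inner_self (A := 𝔄)]
  -- The difference lies in `𝓝(Q)`, yet it is also a difference of two residuals orthogonal to
  -- `𝓝(Q)`.
  have h6 : (ker Q).proj h x - N x = (x - N x) - (x - (ker Q).proj h x) := by abel
  conv_lhs => enter [2]; rw [h6]
  rw [CStarModule.inner_sub_left, horth x _ h5, h4 _ h5, sub_self]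

/-- The initial projection `U† U` commutes with `A`. -/
theorem commute_of_range_adjoint {A : Adjointable 𝔄 E E} (hA : IsSelfAdjoint A)
    {U : Adjointable 𝔄 E F} (hU : IsPartialIsometry U)
    (hr : Set.range U† = closure (Set.range ⇑(A ^ 2 - A))) : Commute A (U† ⊚ U) := by
  have hUU : U† ⊚ U ⊚ U† = U† := congrArg Adjointable.adjoint hU
  have hp : ∀ y ∈ Set.range U†, (U† ⊚ U) y = y := by
    rintro _ ⟨w, rfl⟩; exact DFunLike.congr_fun hUU w
  -- The closed range of `A² - A` is invariant under `A`; self-adjointness of `A` then turns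
  -- invariance into commutation with the projection.
  have hAm : ∀ y ∈ Set.range U†, A y ∈ Set.range U† := by
    rw [hr]
    intro y hy
    refine map_mem_closure A.continuous hy ?_
    rintro _ ⟨x, rfl⟩
    refine ⟨A x, ?_⟩
    change ((A ^ 2 - A) * A) x = (A * (A ^ 2 - A)) x
    rw [sub_mul, mul_sub, ← pow_succ, ← pow_succ']
  have h1 : (U† ⊚ U) * (A * (U† ⊚ U)) = A * (U† ⊚ U) := by
    ext x; exact hp _ (hAm _ ⟨_, rfl⟩)
  have h2 := congrArg star h1
  have hps : star (U† ⊚ U) = U† ⊚ U := rfl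
  rw [star_mul, star_mul, hA.star_eq, hps, mul_assoc, h1] at h2
  exact h2

/-- The operator matrix `Y` of the projection onto `𝓝(Q)` satisfies `Y (1 - X - X†) = 1 - X`, where
`X` is the operator matrix of `Q`. -/
theorem block_comp_one_sub_sub_adjoint {A B L S F' : Adjointable 𝔄 E E} {U : Adjointable 𝔄 E F}
    {Q₀ : Adjointable 𝔄 F F} (hA : IsSelfAdjoint A) (hL : IsSelfAdjoint L)
    (hU : IsPartialIsometry U) (hQ₀ : IsStarProjection Q₀) (hUQ : U† ⊚ Q₀ = 0)
    (hAp : Commute A (U† ⊚ U)) (hB : B * (2 * A - 1) = A) (hF : F' * F' = 1)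
    (hS : S * (2 * A - 1) = L * F') (hFS : Commute F' S) (hFL : Commute F' L)
    (hFB : Commute F' B) :
    block (1 - B) (S ⊚ F' ⊚ U†) (U ⊚ F' ⊚ S) (U ⊚ F' ⊚ B ⊚ F' ⊚ U† +
        (1 - U ⊚ U† - Q₀)) ⊚
      (1 - block A (-(L ⊚ U†)) (U ⊚ L) (U ⊚ (1 - A) ⊚ U† + Q₀) -
        (block A (-(L ⊚ U†)) (U ⊚ L) (U ⊚ (1 - A) ⊚ U† + Q₀))†) =
      1 - block A (-(L ⊚ U†)) (U ⊚ L) (U ⊚ (1 - A) ⊚ U† + Q₀) := by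
  set d := U ⊚ (1 - A) ⊚ U† + Q₀ with hd
  have hUU : U† ⊚ U ⊚ U† = U† := congrArg Adjointable.adjoint hU
  have hQU : Q₀ ⊚ U = 0 := by
    have := congrArg Adjointable.adjoint hUQ
    rwa [adjoint_comp, show Q₀† = Q₀ from hQ₀.isSelfAdjoint, adjoint_zero] at this
  have hds : d† = d := by
    rw [hd, adjoint_add, adjoint_comp, adjoint_comp, adjoint_sub, adjoint_one,
      show A† = A from hA, show Q₀† = Q₀ from hQ₀.isSelfAdjoint, adjoint_adjoint, comp_assoc]
  have hUd : U† ⊚ d = (1 - A) ⊚ U† := by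
    have h1 : (U† ⊚ U) ⊚ (1 - A) = (1 - A) ⊚ (U† ⊚ U) :=
      ((Commute.one_left _).sub_left hAp).symm.eq
    rw [hd, comp_add, hUQ, add_zero, ← comp_assoc, ← comp_assoc, h1, comp_assoc, comp_assoc, hUU]
  -- `U†` intertwines the second diagonal entry `1 - 2d` with `2A - 1`, so the entries of the
  -- product reduce to computations with functions of `A`.
  have hUG : U† ⊚ (1 - d - d) = (2 * A - 1) ⊚ U† := by
    rw [comp_sub, comp_sub, hUd, comp_one, sub_comp, one_comp, two_mul, sub_comp, add_comp,
      one_comp]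
    abel
  have hcol : (1 - block A (-(L ⊚ U†)) (U ⊚ L) d) - (block A (-(L ⊚ U†)) (U ⊚ L) d)† =
      block (-(2 * A - 1)) 0 0 (1 - d - d) := by
    rw [adjoint_block, ← block_one, block_sub, block_sub, adjoint_neg, adjoint_comp, adjoint_comp,
      show L† = L from hL, show A† = A from hA, hds, adjoint_adjoint, two_mul]
    congr 1 <;> abel
  have hQd : (1 - U ⊚ U† - Q₀) ⊚ d = 0 := by
    have h1 : Q₀ ⊚ d = Q₀ := by
      rw [hd, comp_add, ← comp_assoc, hQU, zero_comp, zero_add]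
      exact hQ₀.isIdempotentElem.eq
    rw [sub_comp, sub_comp, h1, comp_assoc, hUd, one_comp, hd]
    abel
  have hSF : S ⊚ F' ⊚ (2 * A - 1) ⊚ U† = L ⊚ U† := by
    rw [← comp_assoc, ← comp_assoc, ← mul_eq_comp S, ← hFS.eq, ← mul_eq_comp, mul_assoc, hS,
      ← mul_assoc, hFL.eq, mul_assoc, hF, mul_one]
  have hFBF : U ⊚ F' ⊚ B ⊚ F' ⊚ U† = U ⊚ B ⊚ U† := by
    have : F' ⊚ B ⊚ F' ⊚ U† = (F' * B * F') ⊚ U† := rfl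
    rw [this, hFB.eq, mul_assoc, hF, mul_one]
  rw [hcol, block_comp, ← block_one, block_sub]
  simp only [comp_zero, zero_add, add_zero]
  congr 1
  · rw [← mul_eq_comp, mul_neg, sub_mul, hB, one_mul, two_mul]
    abel
  · rw [comp_assoc, comp_assoc, hUG, hSF, zero_sub, neg_neg]
  · rw [comp_neg, comp_assoc, comp_assoc, ← mul_eq_comp S, hS, ← mul_eq_comp, hFL.symm.eq,
      ← mul_assoc, hF, one_mul, zero_sub]
  · have h1 : (1 - U ⊚ U† - Q₀) ⊚ (1 - d - d) = 1 - U ⊚ U† - Q₀ := by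
      rw [comp_sub, comp_sub, hQd, comp_one, sub_zero, sub_zero]
    have h2 : B ⊚ (2 * A - 1) ⊚ U† = A ⊚ U† := by
      rw [← comp_assoc, ← mul_eq_comp, hB]
    rw [hFBF, add_comp, h1, comp_assoc, comp_assoc, hUG, h2, hd, sub_comp, comp_sub, one_comp]
    abel

end Kernel

/-- The projection onto the kernel of `Q` in terms of a canonical representation. -/
theorem proj_ker_of_isCanonicalRep {E : Type*} [NormedAddCommGroup E] [NormedSpace ℂ E]
    [SMul 𝔄 E] [CStarModule 𝔄 E] [CompleteSpace E] {P Q : Adjointable 𝔄 E E}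
    {hP : IsStarProjection P} {A : Adjointable 𝔄 (range P hP) (range P hP)}
    {U : Adjointable 𝔄 (range P hP) (ker P)} {Q₀ : Adjointable 𝔄 (ker P) (ker P)}
    (hQ : IsIdempotentElem Q) (h : IsCanonicalRep P hP Q A U Q₀)
    {B : Adjointable 𝔄 (range P hP) (range P hP)} {U₁ : Adjointable 𝔄 (range P hP) (ker P)}
    {Q₁ : Adjointable 𝔄 (ker P) (ker P)} (hB : B = A * Ring.inverse (2 * A - 1))
    (hU₁ : U₁ = U ⊚ cfc signFun A) (hQ₁ : Q₁ = 1 - U₁ ⊚ U₁† - Q₀) :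
    (0 ≤ B ∧ B ≤ 1) ∧ IsPartialIsometry U₁ ∧
      Set.range U₁† = closure (Set.range ⇑(B * (1 - B))) ∧ U₁† ⊚ Q₀ = 0 ∧
      IsStarProjection Q₁ ∧ U₁† ⊚ Q₁ = 0 ∧ (ker Q).IsOrthComplemented ∧
      ∀ hN, splitting P hP ⊚ (ker Q).proj hN ⊚ (splitting P hP)† =
          block (1 - B) (CFC.sqrt B ⊚ CFC.sqrt (1 - B) ⊚ U₁†)
            (U₁ ⊚ CFC.sqrt B ⊚ CFC.sqrt (1 - B)) (U₁ ⊚ B ⊚ U₁† + Q₁) := by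
  have hcalc := gapCalculus h.isSelfAdjoint h.nonneg
  rw [← hB] at hcalc
  set F' := cfc signFun A
  have hFs : F'† = F' := hcalc.isSelfAdjoint_sign
  have hF : F' ⊚ F' = 1 := hcalc.sign_mul_sign
  have hU := h.isPartialIsometry
  have hUU : U† ⊚ U ⊚ U† = U† := congrArg Adjointable.adjoint hU
  have hUQ := h.adjoint_comp
  have hQ₀s : Q₀† = Q₀ := h.isStarProjection.isSelfAdjoint
  have hQU : Q₀ ⊚ U = 0 := by
    have := congrArg Adjointable.adjoint hUQ
    rwa [adjoint_comp, hQ₀s, adjoint_zero] at this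
  have hAp := commute_of_range_adjoint h.isSelfAdjoint hU h.range_adjoint
  have hFp : F' ⊚ U† ⊚ U = (U† ⊚ U) ⊚ F' := (hcalc.of_commute _ hAp).1.eq
  have hU₁' : U₁† = F' ⊚ U† := by rw [hU₁, adjoint_comp, hFs]
  have hU₁U₁ : U₁ ⊚ U₁† = U ⊚ U† := by
    rw [hU₁', hU₁, comp_assoc, ← comp_assoc F', hF, one_comp]
  have hUp : U₁ ⊚ U₁† ⊚ U₁ = U₁ := by
    rw [← comp_assoc, hU₁U₁, hU₁, ← comp_assoc, comp_assoc U, show U ⊚ U† ⊚ U = U from hU]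
  have hU₁Q : U₁† ⊚ Q₀ = 0 := by rw [hU₁', comp_assoc, hUQ, comp_zero]
  have hQU₁ : Q₀ ⊚ U₁ = 0 := by rw [hU₁, ← comp_assoc, hQU, zero_comp]
  have hU₁Q₁ : U₁† ⊚ Q₁ = 0 := by
    rw [hQ₁, comp_sub, comp_sub, hU₁Q, comp_one,
      show U₁† ⊚ U₁ ⊚ U₁† = U₁† from congrArg Adjointable.adjoint hUp, sub_self, sub_zero]
  have hQ₁s : Q₁† = Q₁ := by
    rw [hQ₁, adjoint_sub, adjoint_sub, adjoint_one, adjoint_comp, adjoint_adjoint, hQ₀s]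
  have hQ₁p : IsStarProjection Q₁ := by
    refine ⟨?_, hQ₁s⟩
    have h1 : Q₀ ⊚ Q₁ = 0 := by
      rw [hQ₁, comp_sub, comp_sub, ← comp_assoc, hQU₁, zero_comp, comp_one, sub_zero,
        show Q₀ ⊚ Q₀ = Q₀ from h.isStarProjection.isIdempotentElem.eq, sub_self]
    have h2 : (1 - U₁ ⊚ U₁† - Q₀) ⊚ Q₁ = Q₁ := by
      rw [sub_comp, sub_comp, comp_assoc, hU₁Q₁, h1, comp_zero, one_comp, sub_zero, sub_zero]
    rw [← hQ₁] at h2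
    exact h2
  have hrange : Set.range U₁† = closure (Set.range ⇑(B * (1 - B))) := by
    have hr1 : Set.range U₁† = Set.range U† := by
      ext y
      constructor
      · rintro ⟨x, rfl⟩
        refine ⟨U (F' (U† x)), ?_⟩
        have h1 : (U† ⊚ U) ⊚ F' ⊚ U† = F' ⊚ U† := by
          rw [← comp_assoc, ← hFp, comp_assoc, comp_assoc, hUU]
        rw [hU₁']
        exact DFunLike.congr_fun h1 x
      · rintro ⟨x, rfl⟩
        refine ⟨U (F' (U† x)), ?_⟩
        have h1 : F' ⊚ (U† ⊚ U) ⊚ F' ⊚ U† = U† := by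
          rw [← comp_assoc (U† ⊚ U), ← hFp, comp_assoc, comp_assoc, hUU, ← comp_assoc, hF, one_comp]
        rw [hU₁']
        exact DFunLike.congr_fun h1 x
    -- `A² - A` is `B (1 - B)` times the invertible `(2A - 1)²`, so the ranges agree even before
    -- taking closures.
    obtain ⟨u, hu⟩ := (isUnit_two_mul_sub_one h.isSelfAdjoint h.nonneg).pow 2
    have hr2 : Set.range ⇑(B * (1 - B)) = Set.range ⇑(A ^ 2 - A) := by
      have h1 := hcalc.mul_one_sub
      rw [← hu] at h1
      have h2 : (A ^ 2 - A) * ↑u⁻¹ = B * (1 - B) := by rw [← h1, Units.mul_inv_cancel_right]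
      ext y
      constructor
      · rintro ⟨x, rfl⟩
        exact ⟨u⁻¹.val x, DFunLike.congr_fun h2 x⟩
      · rintro ⟨x, rfl⟩
        exact ⟨u.val x, DFunLike.congr_fun h1 x⟩
    rw [hr1, hr2, h.range_adjoint]
  refine ⟨⟨hcalc.nonneg, hcalc.le_one⟩, hUp, hrange, hU₁Q, hQ₁p, hU₁Q₁, ?_⟩
  set S := CFC.sqrt B * CFC.sqrt (1 - B) with hS
  set Y := block (1 - B) (CFC.sqrt B ⊚ CFC.sqrt (1 - B) ⊚ U₁†)
    (U₁ ⊚ CFC.sqrt B ⊚ CFC.sqrt (1 - B)) (U₁ ⊚ B ⊚ U₁† + Q₁) with hY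
  set X := splitting P hP ⊚ Q ⊚ (splitting P hP)† with hX
  have hY1 : Y = block (1 - B) (S ⊚ F' ⊚ U†) (U ⊚ F' ⊚ S)
      (U ⊚ F' ⊚ B ⊚ F' ⊚ U† + (1 - U ⊚ U† - Q₀)) := by
    rw [hY, hQ₁, hU₁U₁, hU₁', hU₁]; rfl
  have hFA := hcalc.of_commute A (Commute.refl A)
  have hYX : Y ⊚ (1 - X - X†) = 1 - X := by
    rw [hX, h.block_eq, hY1]
    exact block_comp_one_sub_sub_adjoint h.isSelfAdjoint (isSelfAdjoint_ell A) hU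
      h.isStarProjection hUQ hAp hcalc.mul_two_sub hcalc.sign_mul_sign hcalc.sqrt_mul_two_sub
      hcalc.commute (hcalc.of_commute _ hFA.2.2.symm).1 (hcalc.of_commute _ hFA.2.1.symm).1
  have hSs : S† = S := hcalc.isSelfAdjoint_sqrt
  have hBs : B† = B := IsSelfAdjoint.of_nonneg hcalc.nonneg
  have hYs : Y† = Y := by
    have h1 : (U₁ ⊚ B ⊚ U₁† + Q₁)† = U₁ ⊚ B ⊚ U₁† + Q₁ := by
      rw [adjoint_add, adjoint_comp, adjoint_comp, hBs, hQ₁s, adjoint_adjoint, comp_assoc]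
    have h2 : (U ⊚ F' ⊚ S)† = S ⊚ F' ⊚ U† := by
      rw [adjoint_comp, adjoint_comp, hFs, hSs, comp_assoc]
    have h3 : Y = block (1 - B) (S ⊚ F' ⊚ U†) (U ⊚ F' ⊚ S) (U₁ ⊚ B ⊚ U₁† + Q₁) := by
      rw [hY, hU₁', hU₁]; rfl
    rw [h3, adjoint_block, h1, h2, ← h2, adjoint_adjoint, adjoint_sub, adjoint_one, hBs]
  set V := splitting P hP
  have hVV : V ⊚ V† = 1 := splitting_comp_adjoint P hP
  have hVV' : V† ⊚ V = 1 := adjoint_comp_splitting P hP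
  -- Conjugation by the unitary `V` carries the matrix identity back to `E`, where it is the
  -- equation characterising the kernel projection.
  have hN : (V† ⊚ Y ⊚ V) * (1 - Q - star Q) = 1 - Q := by
    have h1 : V ⊚ (1 - Q - Q†) = (1 - X - X†) ⊚ V := by
      rw [hX, adjoint_comp, adjoint_comp, adjoint_adjoint, sub_comp, sub_comp, comp_assoc,
        comp_assoc, comp_assoc, comp_assoc, hVV', comp_one, comp_one, comp_sub, comp_sub, comp_one,
        one_comp]
    have h2 : V† ⊚ (1 - X) ⊚ V = 1 - Q := by
      rw [sub_comp, comp_sub, hX, comp_assoc, comp_assoc, hVV', comp_one, one_comp, ← comp_assoc,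
        hVV', one_comp]
    change (V† ⊚ Y ⊚ V) ⊚ (1 - Q - Q†) = 1 - Q
    rw [comp_assoc, comp_assoc, h1, ← comp_assoc Y, hYX, h2]
  have hNs : IsSelfAdjoint (V† ⊚ Y ⊚ V) := by
    change (V† ⊚ Y ⊚ V)† = _
    rw [adjoint_comp, adjoint_comp, hYs, adjoint_adjoint, comp_assoc]
  obtain ⟨h1, h2⟩ := mul_eq_zero_and_mul_one_sub hQ hNs hN
  obtain ⟨h3, h4⟩ := exists_isOrthComplemented_ker hNs h1 h2
  refine ⟨h3, fun hN => ?_⟩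
  rw [h4 hN, comp_assoc, comp_assoc, hVV, comp_one, ← comp_assoc, hVV, one_comp]

end HilbertCStar

end

open HilbertCStar HilbertCStar.Adjointable in
theorem mainTheorem4 {𝔄 H : Type*}
    [NonUnitalCStarAlgebra 𝔄] [PartialOrder 𝔄] [StarOrderedRing 𝔄]
    [NormedAddCommGroup H] [NormedSpace ℂ H] [SMul 𝔄 H] [CStarModule 𝔄 H] [CompleteSpace H]
    (P Q : Adjointable 𝔄 H H) (hP : IsStarProjection P) (hP0 : P ≠ 0) (hP1 : P ≠ 1)
    (hPQ : IsHarmonious P Q) :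
    (∃ A U Q₀, IsCanonicalRep P hP Q A U Q₀) ∧
    ∃ hN : (ker Q).IsOrthComplemented,
    ∀ A U Q₀, IsCanonicalRep P hP Q A U Q₀ →
      IsUnit (2 * A - 1) ∧
      ∀ B U₁ Q₁, B = A * Ring.inverse (2 * A - 1) → U₁ = U ⊚ cfc signFun A →
        Q₁ = 1 - U₁ ⊚ U₁† - Q₀ →
        (0 ≤ B ∧ B ≤ 1) ∧
        IsPartialIsometry U₁ ∧
        Set.range U₁† = closure (Set.range ⇑(B * (1 - B))) ∧
        U₁† ⊚ Q₀ = 0 ∧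
        IsStarProjection Q₁ ∧
        U₁† ⊚ Q₁ = 0 ∧
        splitting P hP ⊚ (ker Q).proj hN ⊚ (splitting P hP)† =
          block (1 - B) (CFC.sqrt B ⊚ CFC.sqrt (1 - B) ⊚ U₁†)
            (U₁ ⊚ CFC.sqrt B ⊚ CFC.sqrt (1 - B)) (U₁ ⊚ B ⊚ U₁† + Q₁) := by
  obtain ⟨A, U, Q₀, h⟩ := hPQ.exists_isCanonicalRep hP
  -- Complementability of `𝓝(Q)` does not mention the representation, so a single one suffices to
  -- obtain it; the formula is then proved for all of them.
  obtain ⟨-, -, -, -, -, -, hN, -⟩ :=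
    proj_ker_of_isCanonicalRep hPQ.isIdempotentElem h rfl rfl rfl
  refine ⟨⟨A, U, Q₀, h⟩, hN, fun A U Q₀ h => ⟨isUnit_two_mul_sub_one h.isSelfAdjoint h.nonneg, ?_⟩⟩
  intro B U₁ Q₁ hB hU₁ hQ₁
  obtain ⟨h1, h2, h3, h4, h5, h6, -, h7⟩ := proj_ker_of_isCanonicalRep hPQ.isIdempotentElem h hB hU₁ hQ₁
  exact ⟨h1, h2, h3, h4, h5, h6, h7 hN⟩
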